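/- For $m\in\mathbb Z_{\ge 0}$ let $V_m$ be the irreducible $\mathfrak{sl}_2$-module with basis $v^m_0,\dots,v^m_m$ and $$(e_{11}-e_{22})v^m_k=(m-2k)v^m_k,\quad e_{21}v^m_k=(k+1)v^m_{k+1},\quad e_{12}v^m_k=(m-k+1)v^m_{k-1},$$ where $v^m_{-1}=v^m_{m+1}=0$, regarded as a $\mathfrak{gl}_2$-module on which $e_{11}+e_{22}$ acts by $0$. Let $V=\bigotimes_{s=1}^n V_{m_s}$ with $m_s\in\mathbb Z_{>0}$, let $M=\sum_s m_s$, let $z_1,\dots,z_n\in\mathbb C^\times$ be pairwise distinct, and let $V[\nu]=\{v\in V: (e_{11}-e_{22})v=\nu v\}$. For $g\in\mathfrak{gl}_2$ let $g^{(s)}$ denote $g$ acting in the $s$-th factor; $g$ acts on $V$ as $\sum_s g^{(s)}$. *Dynamical Weyl group operator.* Let $\sigma$ act on $V_m$ by $v^m_k\mapsto(-1)^kv^m_{m-k}$ and diagonally on $V$, and let $$\mathcal A(\mu)=\sigma\,p(\mu),\qquad p(\mu)=\sum_{k\ge 0} e_{21}^k e_{12}^k\,\frac1{k!}\prod_{j=0}^{k-1}\frac1{\mu+e_{22}-e_{11}-j}.$$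 *Gaudin operators.* Let $\Omega_0=e_{11}\otimes e_{11}+e_{22}\otimes e_{22}$, $\Omega_+=\frac12\Omega_0+e_{12}\otimes e_{21}$, $\Omega_-=\frac12\Omega_0+e_{21}\otimes e_{12}$, $r(x)=\frac{\Omega_+x+\Omega_-}{x-1}$, and $$\mathcal K_s(z,\mu)=\frac\mu2(e_{11}-e_{22})^{(s)}+\sum_{t\ne s}r^{(s,t)}(z_s/z_t),\qquad s=1,\dots,n.$$ These operators preserve every $V[\nu]$. *Bethe algebra.* Let $x=e^{-2\pi i u}$, so that $\partial_u=-2\pi i\,x\,\partial_x$, let $y_s=\frac1{1-x/z_s}$, and let $$\mathcal M_{11}=2\pi i\sum_s y_s e_{11}^{(s)}-\pi i\,e_{11},\quad \mathcal M_{12}=2\pi i\sum_s y_s e_{21}^{(s)}-2\pi i\,e_{21},\quad \mathcal M_{21}=2\pi i\sum_s y_s e_{12}^{(s)},\quad \mathcal M_{22}=2\pi i\sum_s y_s e_{22}^{(s)}-\pi i\,e_{22}.$$ Write $$(\partial_u-\pi i\mu+\mathcal M_{11})(\partial_u+\pi i\mu+\mathcal M_{22})-\mathcal M_{21}\mathcal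 M_{12}=\partial_u^2+D_1(x)\partial_u+D_2(x).$$ The operators $D_2(a)$, $a\in\mathbb C\setminus\{z_1,\dots,z_n\}$, preserve every $V[\nu]$. The Bethe algebra $\mathcal B(z;\mu;V[\nu])\subset\mathrm{End}(V[\nu])$ is the algebra generated by the identity and the restrictions to $V[\nu]$ of all these $D_2(a)$. **Theorem.** Let $\mu\in\mathbb C$ with $\mu\notin\frac M2+\mathbb Z$. Then for every $\nu\in\mathbb Z$ the operator $\mathcal A(\mu+\frac\nu2-1)$ restricts to an isomorphism of vector spaces $\Phi:V[\nu]\to V[-\nu]$, and the map $T\mapsto\Phi T\Phi^{-1}$ is an isomorphism of algebras $$\mathcal B(z;\mu;V[\nu])\to\mathcal B(z;-\mu;V[-\nu]).$$ Moreover, $\Phi\,\mathcal K_s(z,\mu)|_{V[\nu]}=\mathcal K_s(z,-\mu)|_{V[-\nu]}\,\Phi$ for $s=1,\dots,n$. -/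

import Mathlib

open scoped TensorProduct Nat

noncomputable section

namespace TrigGaudin

/-! ## The irreducible `sl₂`-module `V_m` -/

/-- The underlying space of the irreducible `sl₂`-module `V_m` with highest weight `m`;
`v^m_0, …, v^m_m` is the standard basis. -/
abbrev Irr (m : ℕ) : Type := Fin (m + 1) → ℂ

/-- The vector `v^m_k`, with the convention `v^m_k = 0` for `k > m`. -/
def vec (m k : ℕ) : Irr m := if h : k < m + 1 then Pi.single ⟨k, h⟩ 1 else 0

/-- `e₁₁ - e₂₂` on `V_m`: `v^m_k ↦ (m - 2k) v^m_k`. -/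
def cartan (m : ℕ) : Module.End ℂ (Irr m) :=
  (Pi.basisFun ℂ (Fin (m + 1))).constr ℂ fun k => ((m : ℂ) - 2 * (k : ℕ)) • vec m k

/-- `e₂₁` on `V_m`: `v^m_k ↦ (k + 1) v^m_{k+1}`. -/
def e21 (m : ℕ) : Module.End ℂ (Irr m) :=
  (Pi.basisFun ℂ (Fin (m + 1))).constr ℂ fun k => (((k : ℕ) : ℂ) + 1) • vec m (k + 1)

/-- `e₁₂` on `V_m`: `v^m_k ↦ (m - k + 1) v^m_{k-1}`, where `v^m_{-1} = 0`. -/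
def e12 (m : ℕ) : Module.End ℂ (Irr m) :=
  (Pi.basisFun ℂ (Fin (m + 1))).constr ℂ fun k =>
    if (k : ℕ) = 0 then 0 else ((m : ℂ) - (k : ℕ) + 1) • vec m (k - 1)

/-- `e₁₁` on `V_m` (the central element `e₁₁ + e₂₂` of `gl₂` acts by zero). -/
def e11 (m : ℕ) : Module.End ℂ (Irr m) := (1 / 2 : ℂ) • cartan m

/-- `e₂₂` on `V_m` (the central element `e₁₁ + e₂₂` of `gl₂` acts by zero). -/
def e22 (m : ℕ) : Module.End ℂ (Irr m) := -(1 / 2 : ℂ) • cartan m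

/-- The Weyl involution on `V_m`: `v^m_k ↦ (-1)^k v^m_{m-k}`. -/
def weyl (m : ℕ) : Module.End ℂ (Irr m) :=
  (Pi.basisFun ℂ (Fin (m + 1))).constr ℂ fun k => ((-1 : ℂ) ^ (k : ℕ)) • vec m (m - k)

/-! ## The tensor product `V = V_{m_1} ⊗ ⋯ ⊗ V_{m_n}` -/

variable {n : ℕ}

/-- The tensor product `V = V_{m_1} ⊗ ⋯ ⊗ V_{m_n}`. -/
def TensorV (m : Fin n → ℕ) : Type := ⨂[ℂ] s : Fin n, Irr (m s)

instance (m : Fin n → ℕ) : AddCommGroup (TensorV m) :=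
  inferInstanceAs (AddCommGroup (⨂[ℂ] s : Fin n, Irr (m s)))

instance (m : Fin n → ℕ) : Module ℂ (TensorV m) :=
  inferInstanceAs (Module ℂ (⨂[ℂ] s : Fin n, Irr (m s)))

/-- The pure tensor `x_1 ⊗ ⋯ ⊗ x_n`, as a multilinear map. -/
def pure (m : Fin n → ℕ) : MultilinearMap ℂ (fun s => Irr (m s)) (TensorV m) :=
  PiTensorProduct.tprod ℂ

/-- The operator `g^{(s)} = 1 ⊗ ⋯ ⊗ g ⊗ ⋯ ⊗ 1`, with `g` in the `s`-th factor. -/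
def site (m : Fin n → ℕ) (s : Fin n) (g : Module.End ℂ (Irr (m s))) :
    Module.End ℂ (TensorV m) :=
  PiTensorProduct.map (Function.update (fun _ => LinearMap.id) s g)

/-- The action `∑ₛ g^{(s)}` on `V` of a Lie algebra element that acts by `g k` on `V_k`. -/
def total (m : Fin n → ℕ) (g : ∀ k : ℕ, Module.End ℂ (Irr k)) : Module.End ℂ (TensorV m) :=
  ∑ s, site m s (g (m s))

/-- The Weyl involution, acting diagonally on `V`. -/
def weylV (m : Fin n → ℕ) : Module.End ℂ (TensorV m) :=
  PiTensorProduct.map fun s => weyl (m s)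

/-- The weight subspace `V[ν] = {v ∈ V | (e₁₁ - e₂₂) v = ν v}`. -/
def weightSpace (m : Fin n → ℕ) (ν : ℂ) : Submodule ℂ (TensorV m) :=
  (total m cartan).eigenspace ν

/-- The basis `v^{m_1}_{k_1} ⊗ ⋯ ⊗ v^{m_n}_{k_n}` of `V`. -/
def basisV (m : Fin n → ℕ) : Module.Basis (∀ s, Fin (m s + 1)) ℂ (TensorV m) :=
  Basis.piTensorProduct fun s => Pi.basisFun ℂ (Fin (m s + 1))

/-! ## The dynamical Weyl group operator -/

/-- The operator
`p(μ) = ∑_{k ≥ 0} e₂₁^k e₁₂^k (1 / k!) ∏_{j = 0}^{k-1} (μ + e₂₂ - e₁₁ - j)⁻¹` on `V`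
(only finitely many terms are nonzero). -/
def pOp (m : Fin n → ℕ) (μ : ℂ) : Module.End ℂ (TensorV m) :=
  ∑ᶠ k : ℕ, total m e21 ^ k * total m e12 ^ k * ((k ! : ℂ)⁻¹ •
    ((List.range k).map fun j => Ring.inverse
      (algebraMap ℂ (Module.End ℂ (TensorV m)) (μ - (j : ℂ))
        + total m e22 - total m e11)).prod)

/-- The operator `A(μ) = σ p(μ)` on `V`. -/
def dynWeyl (m : Fin n → ℕ) (μ : ℂ) : Module.End ℂ (TensorV m) :=
  weylV m * pOp m μ

/-! ## Trigonometric Gaudin operators -/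

/-- `Ω₀^{(s,t)}`, where `Ω₀ = e₁₁ ⊗ e₁₁ + e₂₂ ⊗ e₂₂`. -/
def omega0 (m : Fin n → ℕ) (s t : Fin n) : Module.End ℂ (TensorV m) :=
  site m s (e11 (m s)) * site m t (e11 (m t)) + site m s (e22 (m s)) * site m t (e22 (m t))

/-- `Ω₊^{(s,t)}`, where `Ω₊ = Ω₀ / 2 + e₁₂ ⊗ e₂₁`. -/
def omegaPlus (m : Fin n → ℕ) (s t : Fin n) : Module.End ℂ (TensorV m) :=
  (1 / 2 : ℂ) • omega0 m s t + site m s (e12 (m s)) * site m t (e21 (m t))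

/-- `Ω₋^{(s,t)}`, where `Ω₋ = Ω₀ / 2 + e₂₁ ⊗ e₁₂`. -/
def omegaMinus (m : Fin n → ℕ) (s t : Fin n) : Module.End ℂ (TensorV m) :=
  (1 / 2 : ℂ) • omega0 m s t + site m s (e21 (m s)) * site m t (e12 (m t))

/-- The trigonometric `r`-matrix `r^{(s,t)}(x) = (Ω₊ x + Ω₋)^{(s,t)} / (x - 1)`. -/
def rMatrix (m : Fin n → ℕ) (s t : Fin n) (x : ℂ) : Module.End ℂ (TensorV m) :=
  (x - 1)⁻¹ • (x • omegaPlus m s t + omegaMinus m s t)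

/-- The trigonometric Gaudin operator
`K_s(z, μ) = (μ / 2) (e₁₁ - e₂₂)^{(s)} + ∑_{t ≠ s} r^{(s,t)}(z_s / z_t)`. -/
def gaudin (m : Fin n → ℕ) (z : Fin n → ℂ) (μ : ℂ) (s : Fin n) : Module.End ℂ (TensorV m) :=
  (μ / 2) • site m s (cartan (m s)) + ∑ t ∈ Finset.univ.erase s, rMatrix m s t (z s / z t)

/-! ## The universal differential operator -/

/-- The entries `M₁₁, M₁₂, M₂₁, M₂₂` (indexed by `0, 1`), as functions of `x` with values in
`End V`, of the matrix `M = -2πi ∑ₛ r^{(0,s)}(x / z_s)`. -/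
def matM (m : Fin n → ℕ) (z : Fin n → ℂ) : Matrix (Fin 2) (Fin 2) (ℂ → Module.End ℂ (TensorV m)) :=
  !![fun x => (2 * Real.pi * Complex.I : ℂ) • (∑ s, (1 - x / z s)⁻¹ • site m s (e11 (m s)))
        - (Real.pi * Complex.I : ℂ) • total m e11,
     fun x => (2 * Real.pi * Complex.I : ℂ) • (∑ s, (1 - x / z s)⁻¹ • site m s (e21 (m s)))
        - (2 * Real.pi * Complex.I : ℂ) • total m e21;
     fun x => (2 * Real.pi * Complex.I : ℂ) • (∑ s, (1 - x / z s)⁻¹ • site m s (e12 (m s))),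
     fun x => (2 * Real.pi * Complex.I : ℂ) • (∑ s, (1 - x / z s)⁻¹ • site m s (e22 (m s)))
        - (Real.pi * Complex.I : ℂ) • total m e22]

/-- The derivative `∂_u = -2πi x d/dx`, where `x = exp(-2πi u)`, of a `V`-valued function of `x`,
computed in coordinates. -/
def derU (m : Fin n → ℕ) (f : ℂ → TensorV m) : ℂ → TensorV m := fun x =>
  ∑ J, (-2 * Real.pi * Complex.I * x * deriv (fun y => (basisV m).repr (f y) J) x) • basisV m J

/-- The column determinant `a₁₁ a₂₂ - a₂₁ a₁₂` of a `2 × 2`-matrix of operators on `V`-valued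
functions, the product being the composition. -/
def cdet (m : Fin n → ℕ)
    (A : Matrix (Fin 2) (Fin 2) ((ℂ → TensorV m) → (ℂ → TensorV m))) :
    (ℂ → TensorV m) → (ℂ → TensorV m) :=
  fun f => A 0 0 (A 1 1 f) - A 1 0 (A 0 1 f)

/-- The universal trigonometric differential operator with parameter `μ`, acting on `V`-valued
functions of `x`: the column determinant of
`[∂_u - πiμ + M₁₁, M₁₂; M₂₁, ∂_u + πiμ + M₂₂]`. -/
def universalOp (m : Fin n → ℕ) (z : Fin n → ℂ) (μ : ℂ) :
    (ℂ → TensorV m) → (ℂ → TensorV m) :=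
  cdet m
    !![fun f x => derU m f x - (Real.pi * Complex.I * μ : ℂ) • f x + matM m z 0 0 x (f x),
       fun f x => matM m z 0 1 x (f x);
       fun f x => matM m z 1 0 x (f x),
       fun f x => derU m f x + (Real.pi * Complex.I * μ : ℂ) • f x + matM m z 1 1 x (f x)]

/-- The coefficient `D₂(a)` in `D = ∂_u² + D₁(x) ∂_u + D₂(x)`, an operator on `V`: since `∂_u`
annihilates constant functions, `D₂(a) v` is the value at `a` of `D` applied to the constant
function `v` (used here for `v` in the basis of `V`). -/
def coeffD2 (m : Fin n → ℕ) (z : Fin n → ℂ) (μ a : ℂ) : Module.End ℂ (TensorV m) :=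
  (basisV m).constr ℂ fun J => universalOp m z μ (fun _ => basisV m J) a

/-! ## Preservation of the weight subspaces -/

/-- The weight of the basis vector `v^{m_1}_{k_1} ⊗ ⋯ ⊗ v^{m_n}_{k_n}`. -/
def weight (m : Fin n → ℕ) (J : ∀ s, Fin (m s + 1)) : ℂ :=
  ∑ s, ((m s : ℂ) - 2 * ((J s : ℕ) : ℂ))

theorem basisV_apply (m : Fin n → ℕ) (J : ∀ s, Fin (m s + 1)) :
    basisV m J = pure m fun s => (Pi.single (J s) 1 : Irr (m s)) := by
  refine (Basis.piTensorProduct_apply _ J).trans ?_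
  simp only [Pi.basisFun_apply]
  rfl

theorem vec_coe (m : ℕ) (k : Fin (m + 1)) : vec m (k : ℕ) = Pi.single k 1 := by
  simp [vec, k.isLt]

theorem cartan_single (m : ℕ) (k : Fin (m + 1)) :
    cartan m (Pi.single k 1) = ((m : ℂ) - 2 * ((k : ℕ) : ℂ)) • (Pi.single k 1 : Irr m) := by
  have h := (Pi.basisFun ℂ (Fin (m + 1))).constr_basis ℂ
    (fun k => ((m : ℂ) - 2 * (k : ℕ)) • vec m k) k
  rw [Pi.basisFun_apply] at h
  rw [cartan, h, vec_coe]

theorem site_tprod (m : Fin n → ℕ) (s : Fin n) (g : Module.End ℂ (Irr (m s)))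
    (x : ∀ t, Irr (m t)) :
    site m s g (pure m x)
      = pure m (Function.update x s (g (x s))) := by
  refine (PiTensorProduct.map_tprod _ x).trans (congrArg (pure m) ?_)
  funext t
  by_cases h : t = s
  · subst h; simp
  · simp [h]

theorem total_cartan_basisV (m : Fin n → ℕ) (J : ∀ s, Fin (m s + 1)) :
    total m cartan (basisV m J) = weight m J • basisV m J := by
  rw [basisV_apply, total, LinearMap.sum_apply, weight, Finset.sum_smul]
  refine Finset.sum_congr rfl fun s _ => ?_
  rw [site_tprod, cartan_single, MultilinearMap.map_update_smul]
  simp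

theorem mem_weightSpace_iff (m : Fin n → ℕ) (ν : ℂ) (v : TensorV m) :
    v ∈ weightSpace m ν ↔ ∀ J, (basisV m).repr v J ≠ 0 → weight m J = ν := by
  have key : ∀ J, (basisV m).repr (total m cartan v) J = weight m J * (basisV m).repr v J := by
    intro J
    conv_lhs => rw [← (basisV m).sum_repr v]
    simp only [map_sum, map_smul, total_cartan_basisV, Finsupp.coe_finsetSum, Finset.sum_apply,
      Finsupp.smul_apply, Module.Basis.repr_self, smul_eq_mul]
    rw [Finset.sum_eq_single J]
    · simp [mul_comm]
    · intro K _ hK; simp [hK]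
    · simp
  rw [weightSpace, Module.End.mem_eigenspace_iff, ← (basisV m).repr.injective.eq_iff,
    Finsupp.ext_iff]
  refine forall_congr' fun J => ?_
  rw [key]
  simp only [map_smul, Finsupp.smul_apply, smul_eq_mul]
  constructor
  · intro h hJ; exact mul_right_cancel₀ hJ h
  · intro h
    by_cases hJ : (basisV m).repr v J = 0
    · simp [hJ]
    · rw [h hJ]

theorem basisV_mem (m : Fin n → ℕ) (J : ∀ s, Fin (m s + 1)) :
    basisV m J ∈ weightSpace m (weight m J) := by
  rw [weightSpace, Module.End.mem_eigenspace_iff, total_cartan_basisV]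

theorem derU_mem (m : Fin n → ℕ) (ν : ℂ) (f : ℂ → TensorV m)
    (hf : ∀ x, f x ∈ weightSpace m ν) (x : ℂ) : derU m f x ∈ weightSpace m ν := by
  refine Submodule.sum_mem _ fun J _ => ?_
  by_cases h : weight m J = ν
  · exact Submodule.smul_mem _ _ (h ▸ basisV_mem m J)
  · have h0 : (fun y => (basisV m).repr (f y) J) = fun _ => 0 := by
      funext y
      by_contra hy
      exact h ((mem_weightSpace_iff m ν (f y)).1 (hf y) J hy)
    simp [h0]

theorem site_mul (m : Fin n → ℕ) (s : Fin n) (g h : Module.End ℂ (Irr (m s))) :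
    site m s g * site m s h = site m s (g * h) := by
  refine (PiTensorProduct.map_mul _ _).symm.trans (congrArg PiTensorProduct.map ?_)
  funext t
  by_cases ht : t = s
  · subst ht; simp
  · simp [ht]; rfl

theorem site_commute (m : Fin n → ℕ) {s t : Fin n} (hst : s ≠ t) (g : Module.End ℂ (Irr (m s)))
    (h : Module.End ℂ (Irr (m t))) : site m s g * site m t h = site m t h * site m s g := by
  refine (PiTensorProduct.map_mul _ _).symm.trans
    ((congrArg PiTensorProduct.map ?_).trans (PiTensorProduct.map_mul _ _))
  funext r
  by_cases hs : r = s
  · subst hs; simp [hst]; rfl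
  · by_cases ht : r = t
    · subst ht; simp [hs]; rfl
    · simp [hs, ht]

theorem site_sub (m : Fin n → ℕ) (s : Fin n) (g h : Module.End ℂ (Irr (m s))) :
    site m s (g - h) = site m s g - site m s h :=
  map_sub ((PiTensorProduct.mapMultilinear ℂ (fun s => Irr (m s))
    (fun s => Irr (m s))).toLinearMap (fun _ => LinearMap.id) s) g h

theorem site_smul (m : Fin n → ℕ) (s : Fin n) (c : ℂ) (g : Module.End ℂ (Irr (m s))) :
    site m s (c • g) = c • site m s g :=
  PiTensorProduct.map_update_smul _ _ _ _

/-- An operator `g` on `V_{m_s}` of weight `d` gives an operator `g^{(s)}` of weight `d`. -/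
theorem site_mem (m : Fin n → ℕ) (s : Fin n) (d : ℂ) (g : Module.End ℂ (Irr (m s)))
    (hg : cartan (m s) * g - g * cartan (m s) = d • g) {ν ν' : ℂ} (hν : ν' = ν + d)
    {v : TensorV m} (hv : v ∈ weightSpace m ν) : site m s g v ∈ weightSpace m ν' := by
  have hc : total m cartan * site m s g = site m s g * total m cartan + d • site m s g := by
    refine eq_add_of_sub_eq' ?_
    rw [total, Finset.sum_mul, Finset.mul_sum, ← Finset.sum_sub_distrib,
      Finset.sum_eq_single s]
    · rw [site_mul, site_mul, ← site_sub, hg, site_smul]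
    · intro t _ hts
      rw [site_commute m hts, sub_self]
    · simp
  rw [weightSpace, Module.End.mem_eigenspace_iff] at hv ⊢
  have := congrArg (fun T : Module.End ℂ (TensorV m) => T v) hc
  simp only [Module.End.mul_apply, LinearMap.add_apply, LinearMap.smul_apply, hv, map_smul] at this
  rw [this, hν, add_smul]

theorem cartan_vec (m k : ℕ) : cartan m (vec m k) = ((m : ℂ) - 2 * (k : ℂ)) • vec m k := by
  by_cases h : k < m + 1
  · have := cartan_single m ⟨k, h⟩
    rwa [← vec_coe] at this
  · simp [vec, h]

theorem cartan_e21 (m : ℕ) : cartan m * e21 m - e21 m * cartan m = (-2 : ℂ) • e21 m := by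
  refine (Pi.basisFun ℂ (Fin (m + 1))).ext fun k => ?_
  have h := (Pi.basisFun ℂ (Fin (m + 1))).constr_basis ℂ
    (fun k => (((k : ℕ) : ℂ) + 1) • vec m (k + 1)) k
  simp only [LinearMap.sub_apply, LinearMap.smul_apply, Module.End.mul_apply]
  rw [Pi.basisFun_apply] at h ⊢
  rw [cartan_single, map_smul, e21, h, map_smul, cartan_vec]
  push_cast
  module

theorem cartan_e12 (m : ℕ) : cartan m * e12 m - e12 m * cartan m = (2 : ℂ) • e12 m := by
  refine (Pi.basisFun ℂ (Fin (m + 1))).ext fun k => ?_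
  have h := (Pi.basisFun ℂ (Fin (m + 1))).constr_basis ℂ
    (fun k : Fin (m + 1) =>
      if (k : ℕ) = 0 then 0 else ((m : ℂ) - (k : ℕ) + 1) • vec m (k - 1)) k
  simp only [LinearMap.sub_apply, LinearMap.smul_apply, Module.End.mul_apply]
  rw [Pi.basisFun_apply] at h ⊢
  rw [cartan_single, map_smul, e12, h]
  by_cases hk : (k : ℕ) = 0
  · simp [hk]
  · rw [if_neg hk, map_smul, cartan_vec, Nat.cast_sub (Nat.one_le_iff_ne_zero.2 hk)]
    push_cast
    module

section Mem

variable (m : Fin n → ℕ) {ν : ℂ} {v : TensorV m}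

theorem site_cartan_mem (s : Fin n) (hv : v ∈ weightSpace m ν) :
    site m s (cartan (m s)) v ∈ weightSpace m ν :=
  site_mem m s 0 _ (by simp) (by simp) hv

theorem site_e11_mem (s : Fin n) (hv : v ∈ weightSpace m ν) :
    site m s (e11 (m s)) v ∈ weightSpace m ν :=
  site_mem m s 0 _ (by simp [e11]) (by simp) hv

theorem site_e22_mem (s : Fin n) (hv : v ∈ weightSpace m ν) :
    site m s (e22 (m s)) v ∈ weightSpace m ν :=
  site_mem m s 0 _ (by simp [e22]) (by simp) hv

theorem site_e12_mem (s : Fin n) {ν' : ℂ} (hν : ν' = ν + 2) (hv : v ∈ weightSpace m ν) :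
    site m s (e12 (m s)) v ∈ weightSpace m ν' :=
  site_mem m s 2 _ (cartan_e12 _) hν hv

theorem site_e21_mem (s : Fin n) {ν' : ℂ} (hν : ν' = ν + -2) (hv : v ∈ weightSpace m ν) :
    site m s (e21 (m s)) v ∈ weightSpace m ν' :=
  site_mem m s (-2) _ (cartan_e21 _) hν hv

theorem omega0_mem (s t : Fin n) (hv : v ∈ weightSpace m ν) :
    omega0 m s t v ∈ weightSpace m ν :=
  Submodule.add_mem _ (site_e11_mem m s (site_e11_mem m t hv))
    (site_e22_mem m s (site_e22_mem m t hv))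

theorem rMatrix_mem (s t : Fin n) (x : ℂ) (hv : v ∈ weightSpace m ν) :
    rMatrix m s t x v ∈ weightSpace m ν := by
  have h0 := Submodule.smul_mem _ (1 / 2 : ℂ) (omega0_mem m s t hv)
  refine Submodule.smul_mem _ _ (Submodule.add_mem _ (Submodule.smul_mem _ _
    (Submodule.add_mem _ h0 ?_)) (Submodule.add_mem _ h0 ?_))
  · exact site_e12_mem m s (by ring) (site_e21_mem m t rfl hv)
  · exact site_e21_mem m s (by ring) (site_e12_mem m t rfl hv)

theorem gaudin_mem (z : Fin n → ℂ) (μ : ℂ) (s : Fin n) :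
    ∀ v ∈ weightSpace m ν, gaudin m z μ s v ∈ weightSpace m ν := by
  intro v hv
  rw [gaudin, LinearMap.add_apply, LinearMap.sum_apply]
  exact Submodule.add_mem _ (Submodule.smul_mem _ _ (site_cartan_mem m s hv))
    (Submodule.sum_mem _ fun t _ => rMatrix_mem m s t _ hv)

theorem matM_diag_mem (z : Fin n → ℂ) (x : ℂ) (j : Fin 2) (hv : v ∈ weightSpace m ν) :
    matM m z j j x v ∈ weightSpace m ν := by
  fin_cases j
  · simp only [matM, total, LinearMap.sub_apply, LinearMap.smul_apply, LinearMap.sum_apply,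
      Fin.zero_eta, Matrix.of_apply, Matrix.cons_val_zero, Matrix.cons_val', Matrix.cons_val_fin_one]
    exact Submodule.sub_mem _ (Submodule.smul_mem _ _ (Submodule.sum_mem _ fun s _ =>
      Submodule.smul_mem _ _ (site_e11_mem m s hv))) (Submodule.smul_mem _ _
      (Submodule.sum_mem _ fun s _ => site_e11_mem m s hv))
  · simp only [matM, total, LinearMap.sub_apply, LinearMap.smul_apply, LinearMap.sum_apply,
      Fin.mk_one, Matrix.of_apply, Matrix.cons_val_one, Matrix.cons_val', Matrix.cons_val_fin_one]
    exact Submodule.sub_mem _ (Submodule.smul_mem _ _ (Submodule.sum_mem _ fun s _ =>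
      Submodule.smul_mem _ _ (site_e22_mem m s hv))) (Submodule.smul_mem _ _
      (Submodule.sum_mem _ fun s _ => site_e22_mem m s hv))

theorem matM_antidiag_mem (z : Fin n → ℂ) (x : ℂ) (hv : v ∈ weightSpace m ν) :
    matM m z 1 0 x (matM m z 0 1 x v) ∈ weightSpace m ν := by
  have h1 : matM m z 0 1 x v ∈ weightSpace m (ν + -2) := by
    simp only [matM, total, LinearMap.sub_apply, LinearMap.smul_apply, LinearMap.sum_apply,
      Matrix.of_apply, Matrix.cons_val_one, Matrix.cons_val_zero, Matrix.cons_val',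
      Matrix.cons_val_fin_one]
    exact Submodule.sub_mem _ (Submodule.smul_mem _ _ (Submodule.sum_mem _ fun s _ =>
      Submodule.smul_mem _ _ (site_e21_mem m s rfl hv))) (Submodule.smul_mem _ _
      (Submodule.sum_mem _ fun s _ => site_e21_mem m s rfl hv))
  generalize matM m z 0 1 x v = w at h1
  simp only [matM, LinearMap.smul_apply, LinearMap.sum_apply,
    Matrix.of_apply, Matrix.cons_val_one, Matrix.cons_val_zero, Matrix.cons_val',
    Matrix.cons_val_fin_one]
  exact Submodule.smul_mem _ _ (Submodule.sum_mem _ fun s _ =>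
    Submodule.smul_mem _ _ (site_e12_mem m s (by ring) h1))

theorem universalOp_mem (z : Fin n → ℂ) (μ : ℂ) (f : ℂ → TensorV m)
    (hf : ∀ x, f x ∈ weightSpace m ν) (x : ℂ) : universalOp m z μ f x ∈ weightSpace m ν := by
  have hg : ∀ x, derU m f x + (Real.pi * Complex.I * μ : ℂ) • f x + matM m z 1 1 x (f x)
      ∈ weightSpace m ν := fun x =>
    Submodule.add_mem _ (Submodule.add_mem _ (derU_mem m ν f hf x)
      (Submodule.smul_mem _ _ (hf x))) (matM_diag_mem m z x 1 (hf x))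
  exact Submodule.sub_mem _ (Submodule.add_mem _ (Submodule.sub_mem _ (derU_mem m ν _ hg x)
    (Submodule.smul_mem _ _ (hg x))) (matM_diag_mem m z x 0 (hg x)))
    (matM_antidiag_mem m z x (hf x))

theorem coeffD2_mem (z : Fin n → ℂ) (μ a : ℂ) :
    ∀ v ∈ weightSpace m ν, coeffD2 m z μ a v ∈ weightSpace m ν := by
  intro v hv
  rw [coeffD2, Module.Basis.constr_apply_fintype]
  refine Submodule.sum_mem _ fun J _ => ?_
  by_cases hJ : (basisV m).repr v J = 0
  · simp [hJ]
  · have hw := (mem_weightSpace_iff m ν v).1 hv J hJ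
    exact Submodule.smul_mem _ _ (universalOp_mem m z μ _ (fun _ => hw ▸ basisV_mem m J) a)

end Mem

/-! ## Bethe algebras -/

/-- The restriction of the trigonometric Gaudin operator `K_s(z, μ)` to `V[ν]`. -/
def gaudinOn (m : Fin n → ℕ) (z : Fin n → ℂ) (μ ν : ℂ) (s : Fin n) :
    Module.End ℂ (weightSpace m ν) :=
  (gaudin m z μ s).restrict (gaudin_mem m z μ s)

/-- The restriction of `D₂(a)` to `V[ν]`. -/
def coeffD2On (m : Fin n → ℕ) (z : Fin n → ℂ) (μ ν a : ℂ) : Module.End ℂ (weightSpace m ν) :=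
  (coeffD2 m z μ a).restrict (coeffD2_mem m z μ a)

/-- The Bethe algebra `B(z; μ; V[ν])`: the (unital) algebra of operators on `V[ν]` generated by
the identity operator and the operators `D₂(a)`, `a ∈ ℂ - {z_1, …, z_n}`. -/
def betheAlgebra (m : Fin n → ℕ) (z : Fin n → ℂ) (μ ν : ℂ) :
    Subalgebra ℂ (Module.End ℂ (weightSpace m ν)) :=
  Algebra.adjoin ℂ {T | ∃ a : ℂ, (∀ s, a ≠ z s) ∧ T = coeffD2On m z μ ν a}

end TrigGaudin

end

noncomputable section

namespace TrigGaudin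

/-! ## Commutation relations in a copy of `sl₂` acting on an adjoint vector -/

/-! Let `E, F, H` be the diagonal triple on `V`, let `e, f, h` be `e12`, `e21`, `cartan` at site
`s`, and put `X = F e - f E`. Two facts carry the theorem.

Gaudin operators: splitting the r-matrix into an invariant part and a constant skew part gives
`K_s(μ) = I_s + (μ h + X)/2`, where `I_s` commutes with `E`, `F` and `σ` (`gaudin_eq`). On weight
`ν`, `p` exchanges `μ h + X` and `μ h - X`: in `μ[p,h] + pX + Xp` the terms telescope, and the
boundary term dies because `E` and `F` are nilpotent (`intertwine`). Since `σ` anticommutes with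
both `h` and `X`, `σ p` carries `K_s(μ)` to `K_s(-μ)` (`gaudin_weylV`, `dynWeyl_gaudin`).

Bethe algebra: on `V[ν]`, `D₂(a)` is a scalar minus `4π² ∑ y_s K_s` (`coeffD2_apply`). The scalar
depends on `μ, ν` only through `(μ + ν/2)²`, so it survives the change of both signs, and generators
go to generators (`betheAlgebra_map`).

Bijectivity: up to nonzero scalars `E` intertwines `p` on weights `ν` and `ν + 2` (`E_sum`), so
nilpotency of `E` gives injectivity of `p` (`sum_injective`). Injections both ways between `V[ν]`
and `V[-ν]` equate the dimensions. Genericity of `μ` keeps every denominator nonzero, as all weights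
are congruent to `M` modulo 2. -/

/-- `E, F, H` is an `sl₂`-triple and `e, f, h` spans an adjoint representation under commutators
with `E, F, H`. -/
structure AdjointTriple {A : Type*} [Ring A] [Algebra ℂ A] (E F H e f h : A) : Prop where
  E_F : E * F = F * E + H
  H_E : H * E = E * H + (2 : ℂ) • E
  H_F : H * F = F * H - (2 : ℂ) • F
  H_e : H * e = e * H + (2 : ℂ) • e
  E_e : E * e = e * E
  E_f : E * f = f * E + h
  E_h : E * h = h * E - (2 : ℂ) • e
  e_F : e * F = F * e + h
  f_F : f * F = F * f
  h_F : h * F = F * h - (2 : ℂ) • f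

namespace AdjointTriple

section Ring

variable {A : Type*} [Ring A] [Algebra ℂ A] {E F H e f h : A} (r : AdjointTriple E F H e f h)
include r

theorem E_pow_e (k : ℕ) : E ^ k * e = e * E ^ k :=
  (Commute.pow_left (show Commute E e from r.E_e) k)

theorem f_F_pow (k : ℕ) : f * F ^ k = F ^ k * f :=
  (Commute.pow_right (show Commute f F from r.f_F) k)

theorem E_pow_h (k : ℕ) :
    E ^ (k + 1) * h = h * E ^ (k + 1) - (2 * (k + 1) : ℂ) • (e * E ^ k) := by
  induction k with
  | zero => simp [r.E_h]
  | succ k ih =>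
    have h1 : E ^ (k + 1 + 1) * h = E * (E ^ (k + 1) * h) := by rw [pow_succ', mul_assoc]
    rw [h1, ih, mul_sub, mul_smul_comm, ← mul_assoc, ← mul_assoc, r.E_h, r.E_e, sub_mul,
      mul_assoc h, mul_assoc e, ← pow_succ', ← pow_succ', smul_mul_assoc]
    push_cast
    module

theorem h_F_pow (k : ℕ) :
    h * F ^ (k + 1) = F ^ (k + 1) * h - (2 * (k + 1) : ℂ) • (F ^ k * f) := by
  induction k with
  | zero => simp [r.h_F]
  | succ k ih =>
    have h1 : h * F ^ (k + 1 + 1) = h * F ^ (k + 1) * F := by rw [pow_succ F (k + 1), mul_assoc]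
    rw [h1, ih, sub_mul, smul_mul_assoc, mul_assoc, mul_assoc, r.h_F, r.f_F, mul_sub,
      ← mul_assoc, ← mul_assoc (F ^ k), ← pow_succ, ← pow_succ, mul_smul_comm]
    push_cast
    module

theorem E_pow_F (k : ℕ) :
    E ^ (k + 1) * F = F * E ^ (k + 1) + (k + 1 : ℂ) • (E ^ k * H)
      + ((k + 1) * k : ℂ) • E ^ k := by
  induction k with
  | zero => simp [r.E_F]
  | succ k ih =>
    have h1 : E ^ (k + 1 + 1) * F = E ^ (k + 1) * (E * F) := by rw [pow_succ, mul_assoc]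
    have h2 : E ^ (k + 1) * (F * E) = E ^ (k + 1) * F * E := by rw [mul_assoc]
    rw [h1, r.E_F, mul_add, h2, ih, add_mul, add_mul, smul_mul_assoc, smul_mul_assoc, mul_assoc F,
      mul_assoc (E ^ k), r.H_E, mul_add, ← mul_assoc (E ^ k), mul_smul_comm, ← pow_succ,
      ← pow_succ]
    push_cast
    module

theorem E_F_pow (k : ℕ) :
    E * F ^ (k + 1) = F ^ (k + 1) * E + (k + 1 : ℂ) • (F ^ k * H)
      - ((k + 1) * k : ℂ) • F ^ k := by
  induction k with
  | zero => simp [r.E_F]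
  | succ k ih =>
    have h1 : E * F ^ (k + 1 + 1) = E * F ^ (k + 1) * F := by rw [pow_succ F (k + 1), mul_assoc]
    rw [h1, ih, sub_mul, add_mul, smul_mul_assoc, smul_mul_assoc, mul_assoc, r.E_F,
      mul_assoc (F ^ k), r.H_F, mul_sub, mul_add, ← mul_assoc (F ^ (k + 1)), ← mul_assoc (F ^ k),
      mul_smul_comm, ← pow_succ, ← pow_succ]
    push_cast
    module

theorem E_pow_f_E (k : ℕ) :
    E ^ (k + 1) * (f * E) = f * E ^ (k + 2) + (k + 1 : ℂ) • (h * E ^ (k + 1))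
      - ((k + 1) * k : ℂ) • (e * E ^ k) := by
  induction k with
  | zero => simp [← mul_assoc, r.E_f, pow_succ, add_mul]
  | succ k ih =>
    have h1 : E ^ (k + 1 + 1) * (f * E) = E * (E ^ (k + 1) * (f * E)) := by
      rw [pow_succ', mul_assoc]
    rw [h1, ih, mul_sub, mul_add, mul_smul_comm, mul_smul_comm, ← mul_assoc, ← mul_assoc,
      ← mul_assoc, r.E_f, r.E_h, r.E_e, sub_mul, add_mul, smul_mul_assoc, mul_assoc, mul_assoc,
      mul_assoc, ← pow_succ', ← pow_succ', ← pow_succ']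
    push_cast
    module

theorem F_e_F_pow (k : ℕ) :
    F * e * F ^ (k + 1) = F ^ (k + 2) * e + (k + 1 : ℂ) • (F ^ (k + 1) * h)
      - ((k + 1) * k : ℂ) • (F ^ k * f) := by
  induction k with
  | zero => simp [mul_assoc, r.e_F, pow_succ, mul_add]
  | succ k ih =>
    have h1 : F * e * F ^ (k + 1 + 1) = F * e * F ^ (k + 1) * F := by
      rw [pow_succ F (k + 1), ← mul_assoc]
    rw [h1, ih, sub_mul, add_mul, smul_mul_assoc, smul_mul_assoc, mul_assoc, mul_assoc,
      mul_assoc, r.e_F, r.h_F, r.f_F, mul_sub, mul_add, mul_smul_comm, ← mul_assoc, ← mul_assoc,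
      ← mul_assoc, ← pow_succ, ← pow_succ, ← pow_succ]
    push_cast
    module

theorem H_E_pow (k : ℕ) : H * E ^ k = E ^ k * H + (2 * k : ℂ) • E ^ k := by
  induction k with
  | zero => simp
  | succ k ih =>
    rw [pow_succ, ← mul_assoc, ih, add_mul, mul_assoc, r.H_E, mul_add, smul_mul_assoc,
      ← mul_assoc, mul_smul_comm]
    push_cast
    module

/-- With `T_k = F^(k+1) e E^k - F^k f E^(k+1)`, the commutator is `-2(k+1) T_k`. The next two lemmas
are put in the same normal order, powers of `F` on the left and of `E` on the right, so that
everything can be compared with `T_k` and `T_(k+1)`. -/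
theorem commutator_h (k : ℕ) :
    F ^ (k + 1) * E ^ (k + 1) * h - h * (F ^ (k + 1) * E ^ (k + 1)) =
      (2 * (k + 1) : ℂ) • (F ^ k * f * E ^ (k + 1) - F ^ (k + 1) * e * E ^ k) := by
  rw [mul_assoc, r.E_pow_h, ← mul_assoc h, r.h_F_pow, mul_sub, sub_mul, smul_mul_assoc,
    mul_smul_comm, mul_assoc, mul_assoc, mul_assoc]
  module

theorem right_mul_X (k : ℕ) :
    F ^ (k + 1) * E ^ (k + 1) * (F * e - f * E) =
      F ^ (k + 2) * e * E ^ (k + 1) - F ^ (k + 1) * f * E ^ (k + 2)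
        - (k + 1 : ℂ) • (F ^ (k + 1) * h * E ^ (k + 1))
        + (k + 1 : ℂ) • (F ^ (k + 1) * e * E ^ k * H)
        + ((k + 1) * (2 * k + 2) : ℂ) • (F ^ (k + 1) * e * E ^ k) := by
  rw [mul_sub, mul_assoc (F ^ (k + 1)) (E ^ (k + 1)) (f * E), r.E_pow_f_E,
    mul_assoc (F ^ (k + 1)), ← mul_assoc (E ^ (k + 1)), r.E_pow_F, add_mul, add_mul,
    smul_mul_assoc, smul_mul_assoc, mul_assoc F, r.E_pow_e, mul_assoc (E ^ k) H, r.H_e,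
    mul_add (E ^ k), mul_smul_comm, ← mul_assoc (E ^ k) e, r.E_pow_e k]
  simp only [mul_add, mul_sub, mul_smul_comm, ← mul_assoc, ← pow_succ]
  module

/-- The term with `h` is opposite to the one in `right_mul_X`. In the sum of the two products only
`2 T_(k+1) + (k+1) T_k (H + 2k + 2)` remains. -/
theorem left_mul_X (k : ℕ) :
    (F * e - f * E) * (F ^ (k + 1) * E ^ (k + 1)) =
      F ^ (k + 2) * e * E ^ (k + 1) - F ^ (k + 1) * f * E ^ (k + 2)
        + (k + 1 : ℂ) • (F ^ (k + 1) * h * E ^ (k + 1))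
        - (k + 1 : ℂ) • (F ^ k * f * E ^ (k + 1) * H)
        - ((k + 1) * (2 * k + 2) : ℂ) • (F ^ k * f * E ^ (k + 1)) := by
  have h1 : F ^ (k + 1) * E * E ^ (k + 1) = F ^ (k + 1) * E ^ (k + 2) := by
    rw [mul_assoc, ← pow_succ']
  rw [sub_mul, ← mul_assoc (F * e), r.F_e_F_pow, mul_assoc f, ← mul_assoc E, r.E_F_pow]
  simp only [sub_mul, add_mul, smul_mul_assoc]
  rw [h1, mul_assoc (F ^ k) H, r.H_E_pow]
  simp only [mul_add, mul_sub, mul_smul_comm, ← mul_assoc, r.f_F_pow]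
  push_cast
  module

end Ring

end AdjointTriple

/-! ### The coefficients of `p`, and its intertwining and injectivity in an abstract module -/

/-- The coefficient `1 / k! ∏_{j < k} 1 / (t - j)`. -/
def dynCoeff (t : ℂ) (k : ℕ) : ℂ := (k ! : ℂ)⁻¹ * ∏ j ∈ Finset.range k, (t - j)⁻¹

theorem dynCoeff_zero (t : ℂ) : dynCoeff t 0 = 1 := by simp [dynCoeff]

theorem dynCoeff_succ (t : ℂ) (k : ℕ) (h : t - k ≠ 0) :
    (k + 1) * (t - k) * dynCoeff t (k + 1) = dynCoeff t k := by
  have h2 : ((k : ℂ) + 1) ≠ 0 := by exact_mod_cast Nat.succ_ne_zero k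
  have h3 : (k ! : ℂ) ≠ 0 := by exact_mod_cast Nat.factorial_ne_zero k
  rw [dynCoeff, dynCoeff, Finset.prod_range_succ, Nat.factorial_succ]
  push_cast
  field_simp

/-- The products at `t - 1` and at `t` share all but their end factors. Raising the weight by 2
lowers `t = μ - ν/2 - 1` by 1, which is how the shift arises. -/
theorem dynCoeff_sub_one (t : ℂ) (h : ∀ k : ℕ, t - k ≠ 0) (k : ℕ) :
    (t - k) * dynCoeff (t - 1) k = t * dynCoeff t k := by
  induction k with
  | zero => simp [dynCoeff_zero]
  | succ k ih =>
    have h1 := dynCoeff_succ t k (h k)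
    have h0 := h (k + 1)
    push_cast at h0 ⊢
    have h2 := dynCoeff_succ (t - 1) k (by convert h0 using 1; ring)
    have h4 : ((k : ℂ) + 1) ≠ 0 := by exact_mod_cast Nat.succ_ne_zero k
    refine mul_left_cancel₀ (mul_ne_zero h4 (h k)) ?_
    linear_combination (t - k) * h2 - t * h1 + ih

namespace AdjointTriple

variable {W : Type*} [AddCommGroup W] [Module ℂ W] {E F H e f h : Module.End ℂ W}
  (r : AdjointTriple E F H e f h)
include r

/-- With `t = μ - ν/2 - 1`, the bracket at index `k + 1` is `2 T_(k+1) - 2(k+1)(t-k) T_k` on weight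
`ν`. The recursion `dynCoeff_succ` for the coefficients then makes the sum telescope. -/
theorem intertwine_aux (μ ν : ℂ) {v : W} (hv : H v = ν • v)
    (hμ : ∀ k : ℕ, μ - ν / 2 - 1 - k ≠ 0) (N : ℕ) :
    ∑ k ∈ Finset.range (N + 1), dynCoeff (μ - ν / 2 - 1) k •
      (μ • (F ^ k * E ^ k * h - h * (F ^ k * E ^ k)) + F ^ k * E ^ k * (F * e - f * E)
        + (F * e - f * E) * (F ^ k * E ^ k)) v
      = (2 * dynCoeff (μ - ν / 2 - 1) N) •
        (F ^ (N + 1) * e * E ^ N - F ^ N * f * E ^ (N + 1)) v := by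
  induction N with
  | zero =>
    simp [dynCoeff_zero]
    module
  | succ N ih =>
    rw [Finset.sum_range_succ, ih, r.commutator_h, r.right_mul_X, r.left_mul_X,
      ← dynCoeff_succ _ N (hμ N)]
    simp only [LinearMap.add_apply, LinearMap.sub_apply, LinearMap.smul_apply,
      Module.End.mul_apply, hv, map_smul]
    module

/-- The operator `p = ∑ F^k E^k dynCoeff k` exchanges `μ h + X` and `μ h - X`,
`X = F e - f E`, on vectors of weight `ν`. -/
theorem intertwine (μ ν : ℂ) {v : W} (hv : H v = ν • v)
    (hμ : ∀ k : ℕ, μ - ν / 2 - 1 - k ≠ 0) (N : ℕ) (hE : E ^ (N + 1) = 0) (hF : F ^ (N + 1) = 0) :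
    ∑ k ∈ Finset.range (N + 1), dynCoeff (μ - ν / 2 - 1) k •
      (F ^ k * E ^ k) ((μ • h + (F * e - f * E)) v)
      = (μ • h - (F * e - f * E)) (∑ k ∈ Finset.range (N + 1), dynCoeff (μ - ν / 2 - 1) k •
      (F ^ k * E ^ k) v) := by
  have key := r.intertwine_aux μ ν hv hμ N
  rw [hE, hF, zero_mul, zero_mul, mul_zero, sub_zero, LinearMap.zero_apply, smul_zero] at key
  -- The difference of the two sides is `μ[p,h] + pX + Xp` applied to `v`, that is, the sum in
  -- `key`.
  rw [← sub_eq_zero, ← key, map_sum, ← Finset.sum_sub_distrib]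
  refine Finset.sum_congr rfl fun k _ => ?_
  simp only [LinearMap.add_apply, LinearMap.sub_apply, LinearMap.smul_apply,
    Module.End.mul_apply, map_smul, map_add, map_sub]
  module

/-- Moving `E` past `F^(k+1) E^(k+1)` leaves a lower term in `F^k E^k E`, and the sum is regrouped
by `k`. The extra term on the left is the contribution of index `N + 1`, absent from the truncated
sum. -/
theorem E_sum_aux (ν : ℂ) {v : W} (hv : H v = ν • v) (c : ℕ → ℂ) (N : ℕ) :
    E (∑ k ∈ Finset.range (N + 1), c k • (F ^ k * E ^ k) v)
      + (c (N + 1) * ((N + 1) * (ν + N + 2))) • (F ^ N * E ^ N) (E v)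
      = ∑ k ∈ Finset.range (N + 1), (c k + (k + 1) * (ν + k + 2) * c (k + 1)) •
        (F ^ k * E ^ k) (E v) := by
  have step : ∀ k : ℕ, E ((F ^ (k + 1) * E ^ (k + 1)) v) = (F ^ (k + 1) * E ^ (k + 1)) (E v)
      + ((k + 1) * (ν + k + 2) : ℂ) • (F ^ k * E ^ k) (E v) := by
    intro k
    have h1 : E * (F ^ (k + 1) * E ^ (k + 1)) = F ^ (k + 1) * E ^ (k + 1) * E
        + (k + 1 : ℂ) • (F ^ k * E ^ k * E * H) + ((k + 1) * (k + 2) : ℂ) • (F ^ k * E ^ k * E) := by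
      have h2 : F ^ (k + 1) * E * E ^ (k + 1) = F ^ (k + 1) * E ^ (k + 1) * E := by
        rw [mul_assoc, mul_assoc, pow_mul_comm']
      rw [← mul_assoc, r.E_F_pow, sub_mul, add_mul, smul_mul_assoc, smul_mul_assoc,
        mul_assoc (F ^ k) H, r.H_E_pow, h2, pow_succ E k]
      simp only [mul_add, mul_smul_comm, ← mul_assoc]
      push_cast
      module
    have h3 := congrArg (fun T : Module.End ℂ W => T v) h1
    simp only [LinearMap.add_apply, LinearMap.smul_apply, Module.End.mul_apply, hv,
      map_smul] at h3 ⊢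
    rw [h3]
    module
  induction N with
  | zero =>
    simp
    module
  | succ N ih =>
    rw [Finset.sum_range_succ, Finset.sum_range_succ _ (N + 1), ← ih, map_add, map_smul, step]
    push_cast
    module

/-- With `t = μ - ν/2 - 1`, the regrouped coefficients are proportional to those of weight `ν + 2`,
with ratio `(t + ν + 2)/t`. The truncation term vanishes since `E^(N+1) = 0`. -/
theorem E_sum (μ ν : ℂ) {v : W} (hv : H v = ν • v)
    (hμ : ∀ k : ℕ, μ - ν / 2 - 1 - k ≠ 0) (N : ℕ) (hE : E ^ (N + 1) = 0) :
    (μ - ν / 2 - 1) • E (∑ k ∈ Finset.range (N + 1), dynCoeff (μ - ν / 2 - 1) k •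
        (F ^ k * E ^ k) v)
      = (μ + ν / 2 + 1) • ∑ k ∈ Finset.range (N + 1), dynCoeff (μ - (ν + 2) / 2 - 1) k •
        (F ^ k * E ^ k) (E v) := by
  have h1 := r.E_sum_aux ν hv (dynCoeff (μ - ν / 2 - 1)) N
  have h2 : (F ^ N * E ^ N) (E v) = 0 := by
    rw [← Module.End.mul_apply, mul_assoc, ← pow_succ, hE, mul_zero, LinearMap.zero_apply]
  rw [h2, smul_zero, add_zero] at h1
  rw [h1, Finset.smul_sum, Finset.smul_sum]
  refine Finset.sum_congr rfl fun k _ => ?_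
  rw [smul_smul, smul_smul]
  congr 1
  set t := μ - ν / 2 - 1 with ht
  have h3 := dynCoeff_succ t k (hμ k)
  have h4 := dynCoeff_sub_one t hμ k
  rw [show μ - (ν + 2) / 2 - 1 = t - 1 by rw [ht]; ring,
    show μ + ν / 2 + 1 = t + ν + 2 by rw [ht]; ring]
  refine mul_left_cancel₀ (hμ k) ?_
  linear_combination t * (ν + k + 2) * h3 - (t + ν + 2) * h4

/-- The operator `p` is injective on vectors of weight `ν`. -/
theorem sum_injective (μ : ℂ) (N : ℕ) (hE : E ^ (N + 1) = 0) (j : ℕ) :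
    ∀ (ν : ℂ) (v : W), H v = ν • v → (∀ k : ℤ, μ - ν / 2 - k ≠ 0) → (∀ k : ℤ, μ + ν / 2 - k ≠ 0) →
    (E ^ j) v = 0 →
    ∑ k ∈ Finset.range (N + 1), dynCoeff (μ - ν / 2 - 1) k • (F ^ k * E ^ k) v = 0 → v = 0 := by
  induction j with
  | zero => intro ν v _ _ _ h0 _; simpa using h0
  | succ j ih =>
    intro ν v hv hμ hμ' h0 hp
    have hμ1 : ∀ k : ℕ, μ - ν / 2 - 1 - k ≠ 0 := fun k => by
      have := hμ (1 + k)
      push_cast at this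
      rwa [← sub_sub] at this
    have h1 := r.E_sum μ ν hv hμ1 N hE
    -- The scalar `μ + ν/2 + 1` is nonzero, so `p` kills `E v` at weight `ν + 2`. The nonvanishing
    -- hypotheses range over all integers so that they pass to this weight.
    rw [hp, map_zero, smul_zero, eq_comm, smul_eq_zero_iff_right] at h1
    · have h2 : E v = 0 := by
        refine ih (ν + 2) (E v) ?_ (fun k => ?_) (fun k => ?_) ?_ h1
        · have := congrArg (fun T : Module.End ℂ W => T v) r.H_E
          simp only [LinearMap.add_apply, LinearMap.smul_apply, Module.End.mul_apply, hv,
            map_smul] at this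
          rw [this, add_smul]
        · convert hμ (k + 1) using 1
          push_cast
          ring
        · convert hμ' (k - 1) using 1
          push_cast
          ring
        · rwa [← Module.End.mul_apply, ← pow_succ]
      -- Once `E v = 0`, only the term `k = 0` of `p` survives, and it is `v`.
      rw [Finset.sum_range_succ', Finset.sum_eq_zero] at hp
      · simpa [dynCoeff_zero] using hp
      · intro k _
        rw [pow_succ E k, Module.End.mul_apply, Module.End.mul_apply, h2, map_zero, map_zero,
          smul_zero]
    · convert hμ' (-1) using 1
      push_cast
      ring

end AdjointTriple
end TrigGaudin

namespace TrigGaudin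

/-! ## Relations in `End V_m` -/

theorem vec_of_lt {m k : ℕ} (h : m < k) : vec m k = 0 := by
  simp [vec, show ¬ k < m + 1 by omega]

theorem end_ext_vec {m : ℕ} {S T : Module.End ℂ (Irr m)}
    (h : ∀ k ≤ m, S (vec m k) = T (vec m k)) : S = T := by
  refine (Pi.basisFun ℂ (Fin (m + 1))).ext fun k => ?_
  rw [Pi.basisFun_apply, ← vec_coe]
  exact h k (Nat.lt_succ_iff.1 k.isLt)

theorem constr_vec {m k : ℕ} (h : k ≤ m) (w : Fin (m + 1) → Irr m) :
    (Pi.basisFun ℂ (Fin (m + 1))).constr ℂ w (vec m k) = w ⟨k, Nat.lt_succ_iff.2 h⟩ := by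
  have h1 := (Pi.basisFun ℂ (Fin (m + 1))).constr_basis ℂ w ⟨k, Nat.lt_succ_iff.2 h⟩
  rwa [Pi.basisFun_apply, ← vec_coe] at h1

theorem e21_vec (m k : ℕ) : e21 m (vec m k) = ((k : ℂ) + 1) • vec m (k + 1) := by
  rcases le_or_gt k m with h | h
  · rw [e21, constr_vec h]
  · rw [vec_of_lt h, vec_of_lt (h.trans k.lt_succ_self), map_zero, smul_zero]

theorem e12_vec_zero (m : ℕ) : e12 m (vec m 0) = 0 := by
  rw [e12, constr_vec (Nat.zero_le m)]
  simp

theorem e12_vec_succ (m k : ℕ) : e12 m (vec m (k + 1)) = ((m : ℂ) - k) • vec m k := by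
  rcases lt_trichotomy k m with h | h | h
  · rw [e12, constr_vec h]
    simp only [Nat.succ_ne_zero, if_false]
    push_cast
    module
  · rw [vec_of_lt (h ▸ k.lt_succ_self), map_zero, h, sub_self, zero_smul]
  · rw [vec_of_lt h, vec_of_lt (h.trans k.lt_succ_self), map_zero, smul_zero]

theorem weyl_vec {m k : ℕ} (h : k ≤ m) : weyl m (vec m k) = (-1 : ℂ) ^ k • vec m (m - k) := by
  rw [weyl, constr_vec h]

theorem e12_e21 (m : ℕ) : e12 m * e21 m - e21 m * e12 m = cartan m := by
  refine end_ext_vec fun k _ => ?_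
  cases k with
  | zero => simp [e21_vec, e12_vec_succ, e12_vec_zero, cartan_vec]
  | succ k =>
    simp only [LinearMap.sub_apply, Module.End.mul_apply, e21_vec, e12_vec_succ, cartan_vec,
      map_smul]
    push_cast
    module

/-- The quadratic Casimir is scalar on `V_m`. This removes the same-site products `e12 e21` from
`D₂`. -/
theorem casimir (m : ℕ) : e12 m * e21 m =
    ((m : ℂ) * (m + 2) / 4) • (1 : Module.End ℂ (Irr m)) - (1 / 4 : ℂ) • (cartan m * cartan m)
      + (1 / 2 : ℂ) • cartan m := by
  refine end_ext_vec fun k _ => ?_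
  simp only [LinearMap.sub_apply, LinearMap.add_apply, LinearMap.smul_apply,
    Module.End.mul_apply, Module.End.one_apply, e21_vec, e12_vec_succ, cartan_vec, map_smul]
  module

/-- Conjugation by `σ` is the automorphism `e21 ↦ -e12`, `e12 ↦ -e21`, `h ↦ -h`; the sign comes from
the factor `(-1)^k`. -/
theorem weyl_e21 (m : ℕ) : weyl m * e21 m = -e12 m * weyl m := by
  refine end_ext_vec fun k hk => ?_
  obtain ⟨d, rfl⟩ := Nat.exists_eq_add_of_le hk
  simp only [LinearMap.neg_apply, Module.End.mul_apply, e21_vec, weyl_vec hk, map_smul,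
    Nat.add_sub_cancel_left]
  cases d with
  | zero => simp [vec_of_lt, e12_vec_zero]
  | succ d =>
    rw [weyl_vec (by omega), e12_vec_succ, show k + (d + 1) - (k + 1) = d by omega]
    push_cast
    module

theorem weyl_e12 (m : ℕ) : weyl m * e12 m = -e21 m * weyl m := by
  refine end_ext_vec fun k hk => ?_
  obtain ⟨d, rfl⟩ := Nat.exists_eq_add_of_le hk
  simp only [LinearMap.neg_apply, Module.End.mul_apply, e21_vec, weyl_vec hk, map_smul,
    Nat.add_sub_cancel_left]
  cases k with
  | zero => simp [vec_of_lt, e12_vec_zero]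
  | succ k =>
    rw [e12_vec_succ, map_smul, weyl_vec (by omega), show k + 1 + d - k = d + 1 by omega]
    push_cast
    module

theorem weyl_cartan (m : ℕ) : weyl m * cartan m = -cartan m * weyl m := by
  refine end_ext_vec fun k hk => ?_
  obtain ⟨d, rfl⟩ := Nat.exists_eq_add_of_le hk
  simp only [LinearMap.neg_apply, Module.End.mul_apply, cartan_vec, weyl_vec hk, map_smul,
    Nat.add_sub_cancel_left]
  push_cast
  module

theorem weyl_weyl (m : ℕ) : weyl m * weyl m = (-1 : ℂ) ^ m • (1 : Module.End ℂ (Irr m)) := by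
  refine end_ext_vec fun k hk => ?_
  obtain ⟨d, rfl⟩ := Nat.exists_eq_add_of_le hk
  simp only [LinearMap.smul_apply, Module.End.mul_apply, Module.End.one_apply, weyl_vec hk,
    map_smul, Nat.add_sub_cancel_left]
  rw [weyl_vec (by omega), Nat.add_sub_cancel, smul_smul, pow_add]

/-! ## Relations in `End V` -/

variable {n : ℕ} (m : Fin n → ℕ)

theorem site_add (s : Fin n) (g h : Module.End ℂ (Irr (m s))) :
    site m s (g + h) = site m s g + site m s h :=
  PiTensorProduct.map_update_add _ _ _ _

theorem site_neg (s : Fin n) (g : Module.End ℂ (Irr (m s))) :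
    site m s (-g) = -site m s g := by
  rw [← neg_one_smul ℂ g, site_smul, neg_one_smul]

theorem site_one (s : Fin n) : site m s 1 = 1 := by
  refine (congrArg PiTensorProduct.map ?_).trans PiTensorProduct.map_one
  funext t
  by_cases h : t = s
  · subst h; simp
  · simp [h]; rfl

theorem total_commutator_site (g : ∀ k : ℕ, Module.End ℂ (Irr k)) (s : Fin n)
    (a : Module.End ℂ (Irr (m s))) :
    total m g * site m s a - site m s a * total m g = site m s (g (m s) * a - a * g (m s)) := by
  rw [total, Finset.sum_mul, Finset.mul_sum, ← Finset.sum_sub_distrib, Finset.sum_eq_single s]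
  · rw [site_mul, site_mul, ← site_sub]
  · intro t _ hts
    rw [site_commute m hts, sub_self]
  · simp

theorem total_commutator (g h : ∀ k : ℕ, Module.End ℂ (Irr k)) :
    total m g * total m h - total m h * total m g = total m fun k => g k * h k - h k * g k := by
  rw [total.eq_def m h, Finset.mul_sum, Finset.sum_mul, ← Finset.sum_sub_distrib]
  exact Finset.sum_congr rfl fun s _ => total_commutator_site m g s _

theorem total_smul (c : ℂ) (g : ∀ k : ℕ, Module.End ℂ (Irr k)) :
    total m (fun k => c • g k) = c • total m g := by
  simp only [total, site_smul, Finset.smul_sum]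

/-- Operators at different sites commute, so commutators with the diagonal action reduce to
commutators inside the `s`-th factor. -/
theorem adjointTriple (s : Fin n) : AdjointTriple (total m e12) (total m e21) (total m cartan)
    (site m s (e12 (m s))) (site m s (e21 (m s))) (site m s (cartan (m s))) where
  E_F := by
    have := total_commutator m e12 e21
    simp only [e12_e21] at this
    exact eq_add_of_sub_eq' this
  H_E := by
    have := total_commutator m cartan e12
    simp only [cartan_e12] at this
    rw [total_smul] at this
    exact eq_add_of_sub_eq' this
  H_F := by
    have := total_commutator m cartan e21
    simp only [cartan_e21] at this
    rw [total_smul, sub_eq_iff_eq_add'] at this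
    rw [this]
    module
  H_e := by
    have := total_commutator_site m cartan s (e12 (m s))
    rw [cartan_e12, site_smul] at this
    exact eq_add_of_sub_eq' this
  E_e := by
    have := total_commutator_site m e12 s (e12 (m s))
    rw [sub_self, ← zero_smul ℂ (e12 (m s)), site_smul, zero_smul] at this
    exact sub_eq_zero.1 this
  E_f := by
    have := total_commutator_site m e12 s (e21 (m s))
    rw [e12_e21] at this
    exact eq_add_of_sub_eq' this
  E_h := by
    have := total_commutator_site m e12 s (cartan (m s))
    rw [← neg_sub (cartan (m s) * _), cartan_e12, site_neg, site_smul, sub_eq_iff_eq_add'] at this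
    rw [this]
    module
  e_F := by
    have := total_commutator_site m e21 s (e12 (m s))
    rw [← neg_sub (e12 (m s) * _), e12_e21, site_neg, sub_eq_iff_eq_add'] at this
    rw [this]
    module
  f_F := by
    have := total_commutator_site m e21 s (e21 (m s))
    rw [sub_self, ← zero_smul ℂ (e21 (m s)), site_smul, zero_smul] at this
    exact (sub_eq_zero.1 this).symm
  h_F := by
    have := total_commutator_site m e21 s (cartan (m s))
    rw [← neg_sub (cartan (m s) * _), cartan_e21, site_neg, site_smul, sub_eq_iff_eq_add'] at this
    rw [this]
    module

theorem weylV_site (s : Fin n) {a b : Module.End ℂ (Irr (m s))}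
    (h : weyl (m s) * a = b * weyl (m s)) : weylV m * site m s a = site m s b * weylV m := by
  refine (PiTensorProduct.map_mul _ _).symm.trans
    ((congrArg PiTensorProduct.map ?_).trans (PiTensorProduct.map_mul _ _))
  funext t
  by_cases ht : t = s
  · subst ht; simpa using h
  · simp [ht]; rfl

theorem weylV_total {g h : ∀ k : ℕ, Module.End ℂ (Irr k)}
    (H : ∀ k, weyl k * g k = h k * weyl k) : weylV m * total m g = total m h * weylV m := by
  rw [total, total, Finset.mul_sum, Finset.sum_mul]
  exact Finset.sum_congr rfl fun s _ => weylV_site m s (H _)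

theorem total_neg (g : ∀ k : ℕ, Module.End ℂ (Irr k)) :
    total m (fun k => -g k) = -total m g := by
  simp only [total, site_neg, Finset.sum_neg_distrib]

theorem weylV_weylV : weylV m * weylV m = (∏ s, (-1 : ℂ) ^ m s) • 1 := by
  refine (PiTensorProduct.map_mul _ _).symm.trans ?_
  simp only [weyl_weyl]
  refine ((PiTensorProduct.mapMultilinear ℂ (fun s => Irr (m s))
    (fun s => Irr (m s))).map_smul_univ (fun s => (-1 : ℂ) ^ m s) (fun s => 1)).trans ?_
  exact congrArg _ PiTensorProduct.map_one

theorem weylV_injective : Function.Injective (weylV m) := by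
  refine (injective_iff_map_eq_zero _).2 fun v hv => ?_
  have h := congrArg (fun T : Module.End ℂ (TensorV m) => T v) (weylV_weylV m)
  simp only [Module.End.mul_apply, hv, map_zero, LinearMap.smul_apply, Module.End.one_apply] at h
  refine (smul_eq_zero.1 h.symm).resolve_left ?_
  exact Finset.prod_ne_zero_iff.2 fun s _ => pow_ne_zero _ (by norm_num)

theorem weylV_mem {ν : ℂ} {v : TensorV m} (hv : v ∈ weightSpace m ν) :
    weylV m v ∈ weightSpace m (-ν) := by
  have h := weylV_total m weyl_cartan
  rw [total_neg m cartan] at h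
  have h1 := congrArg (fun T : Module.End ℂ (TensorV m) => T v) h
  rw [weightSpace, Module.End.mem_eigenspace_iff] at hv ⊢
  simp only [Module.End.mul_apply, hv, map_smul, LinearMap.neg_apply] at h1
  rw [neg_smul, h1, neg_neg]

/-! ## Weights -/

theorem weight_eq (J : ∀ s, Fin (m s + 1)) :
    weight m J = ((∑ s, m s : ℕ) : ℂ) - 2 * ((∑ s, (J s : ℕ) : ℕ) : ℂ) := by
  rw [weight, Finset.sum_sub_distrib, ← Finset.mul_sum]
  push_cast
  rfl

/-- This transfers genericity from `M` to `ν`: a weight space is either zero or has `ν = M - 2j` for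
an integer `j`. -/
theorem weightSpace_eq_weight {ν : ℂ} {v : TensorV m} (hv : v ∈ weightSpace m ν) (h0 : v ≠ 0) :
    ∃ J, weight m J = ν := by
  by_contra! h
  refine h0 ((basisV m).repr.map_eq_zero_iff.1 (Finsupp.ext fun J => ?_))
  by_contra hJ
  exact h J ((mem_weightSpace_iff m ν v).1 hv J hJ)

theorem total_e12_mem {ν : ℂ} {v : TensorV m} (hv : v ∈ weightSpace m ν) :
    total m e12 v ∈ weightSpace m (ν + 2) := by
  rw [total, LinearMap.sum_apply]
  exact Submodule.sum_mem _ fun s _ => site_e12_mem m s rfl hv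

theorem total_e21_mem {ν : ℂ} {v : TensorV m} (hv : v ∈ weightSpace m ν) :
    total m e21 v ∈ weightSpace m (ν - 2) := by
  rw [total, LinearMap.sum_apply]
  exact Submodule.sum_mem _ fun s _ => site_e21_mem m s (sub_eq_add_neg _ _) hv

theorem total_e12_pow_mem {ν : ℂ} {v : TensorV m} (hv : v ∈ weightSpace m ν) (k : ℕ) :
    (total m e12 ^ k) v ∈ weightSpace m (ν + 2 * k) := by
  induction k with
  | zero => simpa using hv
  | succ k ih =>
    rw [pow_succ', Module.End.mul_apply]
    convert total_e12_mem m ih using 2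
    push_cast
    ring

theorem total_e21_pow_mem {ν : ℂ} {v : TensorV m} (hv : v ∈ weightSpace m ν) (k : ℕ) :
    (total m e21 ^ k) v ∈ weightSpace m (ν - 2 * k) := by
  induction k with
  | zero => simpa using hv
  | succ k ih =>
    rw [pow_succ', Module.End.mul_apply]
    convert total_e21_mem m ih using 2
    push_cast
    ring

theorem sum_index_le (J : ∀ s, Fin (m s + 1)) : ∑ s, (J s : ℕ) ≤ ∑ s, m s :=
  Finset.sum_le_sum fun s _ => Nat.lt_succ_iff.1 (J s).isLt

/-- The sum of the indices lies between `0` and `M`, and this power would lower it by `M + 1`. -/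
theorem total_e12_pow_eq_zero : total m e12 ^ (∑ s, m s + 1) = 0 := by
  refine (basisV m).ext fun J => ?_
  by_contra h
  obtain ⟨K, hK⟩ := weightSpace_eq_weight m (total_e12_pow_mem m (basisV_mem m J) _) h
  rw [weight_eq, weight_eq] at hK
  have h1 : ∑ s, (J s : ℕ) = ∑ s, (K s : ℕ) + (∑ s, m s + 1) := by
    have : ((∑ s, (J s : ℕ) : ℕ) : ℂ) = ((∑ s, (K s : ℕ) + (∑ s, m s + 1) : ℕ) : ℂ) := by
      push_cast at hK ⊢
      linear_combination hK / 2
    exact_mod_cast this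
  have := sum_index_le m J
  omega

theorem total_e21_pow_eq_zero : total m e21 ^ (∑ s, m s + 1) = 0 := by
  refine (basisV m).ext fun J => ?_
  by_contra h
  obtain ⟨K, hK⟩ := weightSpace_eq_weight m (total_e21_pow_mem m (basisV_mem m J) _) h
  rw [weight_eq, weight_eq] at hK
  have h1 : ∑ s, (K s : ℕ) = ∑ s, (J s : ℕ) + (∑ s, m s + 1) := by
    have : ((∑ s, (K s : ℕ) : ℕ) : ℂ) = ((∑ s, (J s : ℕ) + (∑ s, m s + 1) : ℕ) : ℂ) := by
      push_cast at hK ⊢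
      linear_combination -hK / 2
    exact_mod_cast this
  have := sum_index_le m K
  omega

theorem total_e11 : total m e11 = (1 / 2 : ℂ) • total m cartan := total_smul m _ _

theorem total_e22 : total m e22 = (-(1 / 2) : ℂ) • total m cartan := total_smul m _ _

end TrigGaudin

namespace TrigGaudin

variable {n : ℕ} (m : Fin n → ℕ)

/-! ## The dynamical Weyl group operator on a weight subspace -/

/-- The operator `p` on vectors of weight `ν`, as an explicit finite sum. -/
def pSum (μ ν : ℂ) (v : TensorV m) : TensorV m :=
  ∑ k ∈ Finset.range (∑ s, m s + 1), dynCoeff (μ - ν / 2 - 1) k •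
    (total m e21 ^ k * total m e12 ^ k) v

/-- `Ring.inverse` is zero on non-units, so the denominators in `p` must be invertible on all of
`V`, not just on the weight space considered. -/
theorem isUnit_algebraMap_sub_cartan {c : ℂ} (hc : ∀ J, weight m J ≠ c) :
    IsUnit (algebraMap ℂ (Module.End ℂ (TensorV m)) c - total m cartan) := by
  have : Module.Finite ℂ (TensorV m) := Module.Finite.of_basis (basisV m)
  rw [LinearMap.isUnit_iff_ker_eq_bot, eq_bot_iff]
  intro v hv
  rw [LinearMap.mem_ker, LinearMap.sub_apply, Module.algebraMap_end_apply, sub_eq_zero] at hv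
  by_contra h0
  obtain ⟨J, hJ⟩ := weightSpace_eq_weight m (Module.End.mem_eigenspace_iff.2 hv.symm) h0
  exact hc J hJ

theorem inverse_algebraMap_sub_cartan {c ν : ℂ} (hc : ∀ J, weight m J ≠ c) {v : TensorV m}
    (hv : v ∈ weightSpace m ν) (hν : c - ν ≠ 0) :
    Ring.inverse (algebraMap ℂ (Module.End ℂ (TensorV m)) c - total m cartan) v
      = (c - ν)⁻¹ • v := by
  set T := algebraMap ℂ (Module.End ℂ (TensorV m)) c - total m cartan with hT
  have h1 : T v = (c - ν) • v := by
    rw [hT, LinearMap.sub_apply, Module.algebraMap_end_apply, Module.End.mem_eigenspace_iff.1 hv,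
      sub_smul]
  have h2 : Ring.inverse T (T v) = v := by
    rw [← Module.End.mul_apply, Ring.inverse_mul_cancel _ (isUnit_algebraMap_sub_cartan m hc),
      Module.End.one_apply]
  rw [h1, map_smul] at h2
  rw [eq_inv_smul_iff₀ hν, h2]

section Generic

variable {m} {μ : ℂ} (hμ : ∀ k : ℤ, μ ≠ ((∑ s, m s : ℕ) : ℂ) / 2 + (k : ℂ))
include hμ

theorem sub_half_weight_ne (J : ∀ s, Fin (m s + 1)) (k : ℤ) : μ - weight m J / 2 - k ≠ 0 := by
  intro h
  refine hμ (k - (∑ s, (J s : ℕ) : ℕ)) ?_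
  rw [weight_eq] at h
  rw [Int.cast_sub, Int.cast_natCast]
  linear_combination h

theorem add_half_weight_ne (J : ∀ s, Fin (m s + 1)) (k : ℤ) : μ + weight m J / 2 - k ≠ 0 := by
  intro h
  refine hμ (k - (∑ s, m s : ℕ) + (∑ s, (J s : ℕ) : ℕ)) ?_
  rw [weight_eq] at h
  rw [Int.cast_add, Int.cast_sub, Int.cast_natCast, Int.cast_natCast]
  linear_combination h

/-- On weight `ν` the operator `e22 - e11` is `-ν`, which turns the parameter `μ + ν/2 - 1` into `μ
- ν/2 - 1`. -/
theorem pOp_apply {ν : ℂ} {v : TensorV m} (hv : v ∈ weightSpace m ν) :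
    pOp m (μ + ν / 2 - 1) v = pSum m μ ν v := by
  by_cases h0 : v = 0
  · simp [h0, pSum]
  obtain ⟨J, hJ⟩ := weightSpace_eq_weight m hv h0
  have hinv : ∀ j : ℕ, Ring.inverse (algebraMap ℂ (Module.End ℂ (TensorV m))
      (μ + ν / 2 - 1 - (j : ℂ)) + total m e22 - total m e11) v
      = (μ - ν / 2 - 1 - j)⁻¹ • v := by
    intro j
    have h1 : algebraMap ℂ (Module.End ℂ (TensorV m)) (μ + ν / 2 - 1 - (j : ℂ))
        + total m e22 - total m e11
        = algebraMap ℂ (Module.End ℂ (TensorV m)) (μ + ν / 2 - 1 - (j : ℂ))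
        - total m cartan := by
      rw [total_e11, total_e22]
      module
    rw [h1, inverse_algebraMap_sub_cartan m _ hv]
    · congr 2
      ring
    · have := sub_half_weight_ne hμ J (1 + j)
      rw [hJ] at this
      convert this using 1
      push_cast
      ring
    · intro K hK
      -- If `μ + ν/2 - 1 - j` were the weight of `K`, then `μ - M/2` would be this integer.
      refine hμ (1 + j + (∑ s, (J s : ℕ) : ℕ) - 2 * (∑ s, (K s : ℕ) : ℕ)) ?_
      rw [← hJ, weight_eq, weight_eq] at hK
      simp only [Int.cast_sub, Int.cast_add, Int.cast_mul, Int.cast_natCast, Int.cast_one,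
        Int.cast_ofNat]
      linear_combination -hK
  have hprod : ∀ k : ℕ, ((List.range k).map fun j => Ring.inverse
      (algebraMap ℂ (Module.End ℂ (TensorV m)) (μ + ν / 2 - 1 - (j : ℂ))
        + total m e22 - total m e11)).prod v
      = (∏ j ∈ Finset.range k, (μ - ν / 2 - 1 - j)⁻¹) • v := by
    intro k
    -- The coercion of the list of indices to complex numbers is monadic; it is rewritten as an
    -- ordinary map.
    simp only [bind_pure_comp, List.map_eq_map, List.map_map, Function.comp_def]
    induction k with
    | zero => simp
    | succ k ih =>
      rw [List.range_succ, List.map_append, List.prod_append, List.map_singleton,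
        List.prod_singleton, Module.End.mul_apply, hinv, map_smul, ih, smul_smul,
        Finset.prod_range_succ, mul_comm]
  rw [pOp, finsum_eq_sum_of_support_subset (s := Finset.range (∑ s, m s + 1)),
    LinearMap.sum_apply, pSum]
  · refine Finset.sum_congr rfl fun k _ => ?_
    rw [Module.End.mul_apply, LinearMap.smul_apply, hprod, smul_smul, map_smul, dynCoeff]
  · intro k hk
    by_contra hk'
    refine hk ?_
    rw [Finset.coe_range, Set.mem_Iio, not_lt] at hk'
    dsimp only
    rw [pow_eq_zero_of_le hk' (total_e12_pow_eq_zero m), mul_zero, zero_mul]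

theorem dynWeyl_apply {ν : ℂ} {v : TensorV m} (hv : v ∈ weightSpace m ν) :
    dynWeyl m (μ + ν / 2 - 1) v = weylV m (pSum m μ ν v) := by
  rw [dynWeyl, Module.End.mul_apply, pOp_apply hμ hv]

end Generic

variable {m}

theorem pSum_mem (μ : ℂ) {ν : ℂ} {v : TensorV m} (hv : v ∈ weightSpace m ν) :
    pSum m μ ν v ∈ weightSpace m ν := by
  refine Submodule.sum_mem _ fun k _ => Submodule.smul_mem _ _ ?_
  have := total_e21_pow_mem m (total_e12_pow_mem m hv k) k
  rwa [add_sub_cancel_right] at this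

section Generic

variable {μ : ℂ} (hμ : ∀ k : ℤ, μ ≠ ((∑ s, m s : ℕ) : ℂ) / 2 + (k : ℂ))
include hμ

theorem dynWeyl_mem {ν : ℂ} {v : TensorV m} (hv : v ∈ weightSpace m ν) :
    dynWeyl m (μ + ν / 2 - 1) v ∈ weightSpace m (-ν) := by
  rw [dynWeyl_apply hμ hv]
  exact weylV_mem m (pSum_mem μ hv)

theorem pSum_eq_zero {ν : ℂ} {v : TensorV m} (hv : v ∈ weightSpace m ν)
    (h : pSum m μ ν v = 0) : v = 0 := by
  by_contra h0
  obtain ⟨J, hJ⟩ := weightSpace_eq_weight m hv h0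
  -- An adjoint triple needs a site. For `n = 0` the sum has the single term `k = 0`, so `p` is the
  -- identity.
  have : Nonempty (Fin n) := by
    by_contra hn
    rw [not_nonempty_iff] at hn
    refine h0 ?_
    rw [pSum] at h
    simpa [dynCoeff_zero] using h
  refine h0 ((adjointTriple m (Classical.arbitrary (Fin n))).sum_injective μ _
    (total_e12_pow_eq_zero m) (∑ s, m s + 1) ν v (Module.End.mem_eigenspace_iff.1 hv)
    (fun k => ?_) (fun k => ?_) (by rw [total_e12_pow_eq_zero, LinearMap.zero_apply]) h)
  · rw [← hJ]
    exact sub_half_weight_ne hμ J k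
  · rw [← hJ]
    exact add_half_weight_ne hμ J k

/-- The restriction of the dynamical Weyl group operator to a weight subspace. -/
def dynWeylOn (ν : ℂ) : weightSpace m ν →ₗ[ℂ] weightSpace m (-ν) :=
  (dynWeyl m (μ + ν / 2 - 1)).restrict fun _ hv => dynWeyl_mem hμ hv

theorem dynWeylOn_injective (ν : ℂ) : Function.Injective (dynWeylOn hμ ν) := by
  refine (injective_iff_map_eq_zero _).2 fun v hv => ?_
  have h1 : dynWeyl m (μ + ν / 2 - 1) v = 0 := congrArg Subtype.val hv
  rw [dynWeyl_apply hμ v.2] at h1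
  exact Subtype.ext (pSum_eq_zero hμ v.2
    ((map_eq_zero_iff _ (weylV_injective m)).1 h1))

/-- The hypothesis on `μ` does not involve `ν`, so the injection exists for `ν` and for `-ν`. -/
theorem finrank_weightSpace_neg (ν : ℂ) :
    Module.finrank ℂ (weightSpace m ν) = Module.finrank ℂ (weightSpace m (-ν)) := by
  have : Module.Finite ℂ (TensorV m) := Module.Finite.of_basis (basisV m)
  refine le_antisymm (LinearMap.finrank_le_finrank_of_injective (dynWeylOn_injective hμ ν)) ?_
  have := LinearMap.finrank_le_finrank_of_injective (dynWeylOn_injective hμ (-ν))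
  rwa [neg_neg] at this

/-- The isomorphism `V[ν] ≃ V[-ν]` given by the dynamical Weyl group operator. -/
def dynWeylEquiv (ν : ℂ) : weightSpace m ν ≃ₗ[ℂ] weightSpace m (-ν) :=
  have : Module.Finite ℂ (TensorV m) := Module.Finite.of_basis (basisV m)
  LinearEquiv.ofInjectiveOfFinrankEq (dynWeylOn hμ ν) (dynWeylOn_injective hμ ν)
    (finrank_weightSpace_neg hμ ν)

theorem dynWeylEquiv_apply (ν : ℂ) (v : weightSpace m ν) :
    (dynWeylEquiv hμ ν v : TensorV m) = dynWeyl m (μ + ν / 2 - 1) v := rfl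

end Generic

/-! ## The Gaudin operators -/

variable (m)

/-- The invariant tensor `h ⊗ h / 2 + e₁₂ ⊗ e₂₁ + e₂₁ ⊗ e₁₂` in the factors `s` and `t`. -/
def omega (s t : Fin n) : Module.End ℂ (TensorV m) :=
  (1 / 2 : ℂ) • (site m s (cartan (m s)) * site m t (cartan (m t)))
    + site m s (e12 (m s)) * site m t (e21 (m t)) + site m s (e21 (m s)) * site m t (e12 (m t))

/-- `omega` is the polarized Casimir, hence invariant: the contributions of the two sites cancel. -/
theorem total_e12_omega (s t : Fin n) : total m e12 * omega m s t = omega m s t * total m e12 := by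
  have rs := adjointTriple m s
  have rt := adjointTriple m t
  simp only [omega, mul_add, add_mul, mul_smul_comm, smul_mul_assoc, ← mul_assoc, rs.E_h, rs.E_e,
    rs.E_f, sub_mul]
  simp only [mul_assoc, rt.E_h, rt.E_e, rt.E_f, mul_sub, mul_add, mul_smul_comm]
  module

theorem total_e21_omega (s t : Fin n) : total m e21 * omega m s t = omega m s t * total m e21 := by
  have rs := adjointTriple m s
  have rt := adjointTriple m t
  simp only [omega, mul_add, add_mul, mul_smul_comm, smul_mul_assoc, mul_assoc, rt.h_F, rt.e_F,
    rt.f_F, mul_sub]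
  simp only [← mul_assoc, rs.h_F, rs.e_F, rs.f_F, sub_mul, add_mul, smul_mul_assoc]
  module

theorem weylV_omega (s t : Fin n) : weylV m * omega m s t = omega m s t * weylV m := by
  simp only [omega, mul_add, add_mul, mul_smul_comm, smul_mul_assoc, ← mul_assoc,
    weylV_site m s (weyl_cartan (m s)), weylV_site m s (weyl_e12 (m s)),
    weylV_site m s (weyl_e21 (m s))]
  simp only [mul_assoc, weylV_site m t (weyl_cartan (m t)), weylV_site m t (weyl_e12 (m t)),
    weylV_site m t (weyl_e21 (m t)), site_neg, neg_mul, mul_neg, neg_neg]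
  module

theorem omega0_eq (s t : Fin n) : omega0 m s t =
    (1 / 2 : ℂ) • (site m s (cartan (m s)) * site m t (cartan (m t))) := by
  simp only [omega0, e11, e22, site_smul, smul_mul_assoc, mul_smul_comm]
  module

/-- Write `(x Ω₊ + Ω₋)/(x - 1)` through `Ω₊ + Ω₋`, which is invariant, and `Ω₊ - Ω₋`, whose
coefficient `1/2` does not depend on `x`. -/
theorem rMatrix_eq (s t : Fin n) {x : ℂ} (hx : x ≠ 1) : rMatrix m s t x =
    ((x + 1) / (2 * (x - 1))) • omega m s t
      + (1 / 2 : ℂ) • (site m s (e12 (m s)) * site m t (e21 (m t))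
        - site m s (e21 (m s)) * site m t (e12 (m t))) := by
  have := sub_ne_zero.2 hx
  rw [rMatrix, omegaPlus, omegaMinus, omega0_eq, omega]
  match_scalars <;> field_simp <;> ring

/-- The `sl₂`-invariant part of the Gaudin operator. -/
def gaudinInv (z : Fin n → ℂ) (s : Fin n) : Module.End ℂ (TensorV m) :=
  ∑ t ∈ Finset.univ.erase s, ((z s / z t + 1) / (2 * (z s / z t - 1))) • omega m s t

theorem total_e12_gaudinInv (z : Fin n → ℂ) (s : Fin n) :
    Commute (total m e12) (gaudinInv m z s) := by
  refine Commute.sum_right _ _ _ fun t _ => Commute.smul_right (total_e12_omega m s t) _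

theorem total_e21_gaudinInv (z : Fin n → ℂ) (s : Fin n) :
    Commute (total m e21) (gaudinInv m z s) := by
  refine Commute.sum_right _ _ _ fun t _ => Commute.smul_right (total_e21_omega m s t) _

theorem weylV_gaudinInv (z : Fin n → ℂ) (s : Fin n) :
    Commute (weylV m) (gaudinInv m z s) := by
  refine Commute.sum_right _ _ _ fun t _ => Commute.smul_right (weylV_omega m s t) _

theorem total_erase (g : ∀ k : ℕ, Module.End ℂ (Irr k)) (s : Fin n) :
    ∑ t ∈ Finset.univ.erase s, site m t (g (m t)) = total m g - site m s (g (m s)) := by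
  rw [total, ← Finset.sum_erase_add _ _ (Finset.mem_univ s), add_sub_cancel_right]

variable {m} {z : Fin n → ℂ} (hz0 : ∀ s, z s ≠ 0) (hz : Function.Injective z)
include hz0 hz

/-- The skew parts add up to `e (F - f) - f (E - e) = e F - f E - h`, and `e F = F e + h` turns this
into `X`. -/
theorem gaudin_eq (μ : ℂ) (s : Fin n) : gaudin m z μ s = gaudinInv m z s +
    (1 / 2 : ℂ) • (μ • site m s (cartan (m s)) + (total m e21 * site m s (e12 (m s))
      - site m s (e21 (m s)) * total m e12)) := by
  have h1 : ∀ t ∈ Finset.univ.erase s, rMatrix m s t (z s / z t) =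
      ((z s / z t + 1) / (2 * (z s / z t - 1))) • omega m s t
      + (1 / 2 : ℂ) • (site m s (e12 (m s)) * site m t (e21 (m t))
        - site m s (e21 (m s)) * site m t (e12 (m t))) := by
    intro t ht
    refine rMatrix_eq m s t fun h => (Finset.ne_of_mem_erase ht).symm (hz ?_)
    exact (div_eq_one_iff_eq (hz0 t)).1 h
  have h2 := site_mul m s (e12 (m s)) (e21 (m s))
  have h3 : site m s (e12 (m s) * e21 (m s)) = site m s (e21 (m s) * e12 (m s))
      + site m s (cartan (m s)) := by
    rw [← site_add, ← e12_e21]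
    congr 1
    abel
  rw [gaudin, Finset.sum_congr rfl h1, Finset.sum_add_distrib, ← Finset.smul_sum,
    Finset.sum_sub_distrib, ← Finset.mul_sum, ← Finset.mul_sum, total_erase, total_erase, mul_sub,
    mul_sub, h2, site_mul, h3, (adjointTriple m s).e_F, gaudinInv]
  module

/-- `σ` sends `F e` to `E f = f E + h` and `f E` to `e F = F e + h`. The two `h` cancel, so `σ X =
-X σ`. -/
theorem gaudin_weylV (μ : ℂ) (s : Fin n) : gaudin m z (-μ) s * weylV m =
    weylV m * (gaudinInv m z s + (1 / 2 : ℂ) • (μ • site m s (cartan (m s)) -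
      (total m e21 * site m s (e12 (m s)) - site m s (e21 (m s)) * total m e12))) := by
  have r := adjointTriple m s
  have h1 := weylV_site m s (weyl_cartan (m s))
  have h2 : weylV m * (total m e21 * site m s (e12 (m s)))
      = total m e12 * site m s (e21 (m s)) * weylV m := by
    rw [← mul_assoc, weylV_total m weyl_e21, mul_assoc, weylV_site m s (weyl_e12 (m s)),
      total_neg, site_neg, neg_mul, neg_mul, mul_neg, neg_neg, mul_assoc]
  have h3 : weylV m * (site m s (e21 (m s)) * total m e12)
      = site m s (e12 (m s)) * total m e21 * weylV m := by
    rw [← mul_assoc, weylV_site m s (weyl_e21 (m s)), mul_assoc, weylV_total m weyl_e12,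
      total_neg, site_neg, neg_mul, neg_mul, mul_neg, neg_neg, mul_assoc]
  rw [gaudin_eq hz0 hz, mul_add, (weylV_gaudinInv m z s).eq, mul_smul_comm, mul_sub, mul_smul_comm,
    mul_sub, h1, h2, h3, r.E_f, r.e_F, site_neg]
  simp only [add_mul, sub_mul, smul_mul_assoc, neg_mul]
  module

/-- The dynamical Weyl group operator intertwines the Gaudin operators. -/
theorem dynWeyl_gaudin {μ : ℂ} (hμ : ∀ k : ℤ, μ ≠ ((∑ s, m s : ℕ) : ℂ) / 2 + (k : ℂ)) {ν : ℂ}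
    {v : TensorV m} (hv : v ∈ weightSpace m ν) (s : Fin n) :
    dynWeyl m (μ + ν / 2 - 1) (gaudin m z μ s v)
      = gaudin m z (-μ) s (dynWeyl m (μ + ν / 2 - 1) v) := by
  by_cases h0 : v = 0
  · simp [h0]
  obtain ⟨J, hJ⟩ := weightSpace_eq_weight m hv h0
  have r := adjointTriple m s
  have h1 := r.intertwine μ ν (Module.End.mem_eigenspace_iff.1 hv) (fun k => by
    have := sub_half_weight_ne hμ J (1 + k)
    rw [hJ] at this
    push_cast at this
    rwa [← sub_sub] at this) _ (total_e12_pow_eq_zero m) (total_e21_pow_eq_zero m)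
  -- The invariant part commutes with every `F^k E^k`, hence with `p`.
  have h2 : ∀ w : TensorV m, pSum m μ ν (gaudinInv m z s w) = gaudinInv m z s (pSum m μ ν w) := by
    intro w
    rw [pSum, pSum, map_sum]
    refine Finset.sum_congr rfl fun k _ => ?_
    have hc : Commute (total m e21 ^ k * total m e12 ^ k) (gaudinInv m z s) :=
      ((total_e21_gaudinInv m z s).pow_left k).mul_left ((total_e12_gaudinInv m z s).pow_left k)
    rw [map_smul, ← Module.End.mul_apply _ (gaudinInv m z s), hc.eq, Module.End.mul_apply]
  have h3 := congrArg (fun T : Module.End ℂ (TensorV m) => T (pSum m μ ν v))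
    (gaudin_weylV hz0 hz μ s)
  rw [dynWeyl_apply hμ (gaudin_mem m z μ s v hv), dynWeyl_apply hμ hv]
  refine Eq.trans ?_ h3.symm
  rw [Module.End.mul_apply]
  refine congrArg (weylV m) ?_
  have h4 : ∀ (a b : TensorV m) (c : ℂ), pSum m μ ν (a + c • b)
      = pSum m μ ν a + c • pSum m μ ν b := by
    intro a b c
    simp only [pSum, map_add, map_smul, smul_add, Finset.sum_add_distrib, Finset.smul_sum,
      smul_comm c]
  rw [gaudin_eq hz0 hz, LinearMap.add_apply, LinearMap.smul_apply, h4, h2, LinearMap.add_apply,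
    LinearMap.smul_apply]
  congr 2

end TrigGaudin

namespace TrigGaudin

variable {n : ℕ} (m : Fin n → ℕ)

/-! ## The coefficient `D₂` in terms of the Gaudin operators -/

theorem derU_sum {g g' : Fin n → ℂ → ℂ} {a : ℂ} (hg : ∀ s, HasDerivAt (g s) (g' s a) a)
    (w₀ : TensorV m) (w : Fin n → TensorV m) :
    derU m (fun x => w₀ + ∑ s, g s x • w s) a
      = ∑ s, (-2 * Real.pi * Complex.I * a * g' s a) • w s := by
  have h1 : ∀ J, deriv (fun y => (basisV m).repr (w₀ + ∑ s, g s y • w s) J) a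
      = ∑ s, g' s a * (basisV m).repr (w s) J := by
    intro J
    have h2 : (fun y => (basisV m).repr (w₀ + ∑ s, g s y • w s) J)
        = fun y => (basisV m).repr w₀ J + ∑ s, g s y * (basisV m).repr (w s) J := by
      funext y
      simp [Finsupp.coe_finsetSum, Finset.sum_apply]
    rw [h2]
    exact ((HasDerivAt.fun_sum fun s _ => (hg s).mul_const _).const_add _).deriv
  have h3 : ∀ s, (-2 * Real.pi * Complex.I * a * g' s a) • w s
      = ∑ J, (-2 * Real.pi * Complex.I * a * g' s a * (basisV m).repr (w s) J) • basisV m J := by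
    intro s
    conv_lhs => rw [← (basisV m).sum_repr (w s)]
    rw [Finset.smul_sum]
    exact Finset.sum_congr rfl fun J _ => smul_smul _ _ _
  simp only [derU, h1, h3]
  rw [Finset.sum_comm]
  refine Finset.sum_congr rfl fun J _ => ?_
  rw [← Finset.sum_smul, Finset.mul_sum]
  exact congrArg (· • basisV m J) (Finset.sum_congr rfl fun s _ => by ring)

theorem derU_const (v : TensorV m) (x : ℂ) : derU m (fun _ => v) x = 0 := by
  simp [derU]

theorem hasDerivAt_inv_one_sub_div {a c : ℂ} (hc : c ≠ 0) (ha : a ≠ c) :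
    HasDerivAt (fun x : ℂ => (1 - x / c)⁻¹) (c⁻¹ * ((1 - a / c)⁻¹) ^ 2) a := by
  have h0 : 1 - a / c ≠ 0 := by
    rw [sub_ne_zero]
    exact fun h => ha ((div_eq_one_iff_eq hc).1 h.symm)
  have h1 : HasDerivAt (fun x : ℂ => 1 - x / c) (-(1 / c)) a :=
    ((hasDerivAt_id a).div_const c).const_sub 1
  have h2 := h1.fun_inv h0
  rwa [neg_neg, one_div, div_eq_mul_inv, ← inv_pow] at h2

theorem sum_erase_swap {A : Type*} [AddCommMonoid A] (g : Fin n → Fin n → A) :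
    ∑ s, ∑ t ∈ Finset.univ.erase s, g s t = ∑ s, ∑ t ∈ Finset.univ.erase s, g t s :=
  Finset.sum_comm' fun s t => by simp [eq_comm]

/-- Off-diagonal double sums need to agree only after adding the terms at `(s, t)` and `(t, s)`. -/
theorem sum_erase_eq_of_symm {A : Type*} [AddCommGroup A] [Module ℂ A] {g g' : Fin n → Fin n → A}
    (h : ∀ s t, s ≠ t → g s t + g t s = g' s t + g' t s) :
    ∑ s, ∑ t ∈ Finset.univ.erase s, g s t = ∑ s, ∑ t ∈ Finset.univ.erase s, g' s t := by
  have key : ∀ k : Fin n → Fin n → A, ∑ s, ∑ t ∈ Finset.univ.erase s, (k s t + k t s)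
      = (2 : ℂ) • ∑ s, ∑ t ∈ Finset.univ.erase s, k s t := by
    intro k
    simp only [Finset.sum_add_distrib]
    rw [← sum_erase_swap, two_smul]
  have h2 : (2 : ℂ) • ∑ s, ∑ t ∈ Finset.univ.erase s, g s t
      = (2 : ℂ) • ∑ s, ∑ t ∈ Finset.univ.erase s, g' s t := by
    rw [← key, ← key]
    exact Finset.sum_congr rfl fun s _ => Finset.sum_congr rfl fun t ht =>
      h s t (Finset.ne_of_mem_erase ht).symm
  exact smul_right_injective A (two_ne_zero : (2 : ℂ) ≠ 0) h2

theorem sum_mul_sum_erase {A : Type*} [Ring A] (a b : Fin n → A) :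
    (∑ s, a s) * ∑ t, b t = ∑ s, a s * b s + ∑ s, ∑ t ∈ Finset.univ.erase s, a s * b t := by
  rw [Finset.sum_mul, ← Finset.sum_add_distrib]
  refine Finset.sum_congr rfl fun s _ => ?_
  rw [Finset.mul_sum]
  exact (Finset.add_sum_erase _ (fun t => a s * b t) (Finset.mem_univ s)).symm

/-- The operator `D₂(a) / π²` in terms of `y_s = 1 / (1 - a / z_s)`. -/
def rawD2 (y : Fin n → ℂ) (μ : ℂ) : Module.End ℂ (TensorV m) :=
  (-2 : ℂ) • ∑ s, (y s * (y s - 1)) • site m s (cartan (m s))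
    + (∑ s, (y s - 1 / 2) • site m s (cartan (m s)) - μ • 1)
      * (∑ s, (y s - 1 / 2) • site m s (cartan (m s)) - μ • 1)
    + (4 : ℂ) • ((∑ s, y s • site m s (e12 (m s))) * ∑ s, (y s - 1) • site m s (e21 (m s)))

/-- With `G = ∑ (y_s - 1/2) h_s`, the diagonal entries are `πi G` and `-πi G`, giving the square of
`G - μ`. The linear term in `h_s` comes from `∂_u y_s = -2πi y_s (y_s - 1)`. -/
theorem coeffD2_eq_rawD2 {z : Fin n → ℂ} (hz0 : ∀ s, z s ≠ 0) (μ : ℂ) {a : ℂ}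
    (ha : ∀ s, a ≠ z s) :
    coeffD2 m z μ a = ((Real.pi : ℂ) ^ 2) • rawD2 m (fun s => (1 - a / z s)⁻¹) μ := by
  refine (basisV m).ext fun J => ?_
  rw [coeffD2, Module.Basis.constr_basis]
  set v := basisV m J
  have hM00 : ∀ x, matM m z 0 0 x = (Real.pi * Complex.I : ℂ) •
      ∑ s, ((1 - x / z s)⁻¹ - 1 / 2) • site m s (cartan (m s)) := by
    intro x
    change (2 * Real.pi * Complex.I : ℂ) • (∑ s, (1 - x / z s)⁻¹ • site m s (e11 (m s)))
        - (Real.pi * Complex.I : ℂ) • total m e11 = _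
    simp only [total, Finset.smul_sum, ← Finset.sum_sub_distrib, e11, site_smul]
    refine Finset.sum_congr rfl fun s _ => ?_
    module
  have hM11 : ∀ x, matM m z 1 1 x = (-(Real.pi * Complex.I) : ℂ) •
      ∑ s, ((1 - x / z s)⁻¹ - 1 / 2) • site m s (cartan (m s)) := by
    intro x
    change (2 * Real.pi * Complex.I : ℂ) • (∑ s, (1 - x / z s)⁻¹ • site m s (e22 (m s)))
        - (Real.pi * Complex.I : ℂ) • total m e22 = _
    simp only [total, Finset.smul_sum, ← Finset.sum_sub_distrib, e22, site_smul]
    refine Finset.sum_congr rfl fun s _ => ?_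
    module
  have hM01 : matM m z 0 1 a = (2 * Real.pi * Complex.I : ℂ) •
      ∑ s, ((1 - a / z s)⁻¹ - 1) • site m s (e21 (m s)) := by
    change (2 * Real.pi * Complex.I : ℂ) • (∑ s, (1 - a / z s)⁻¹ • site m s (e21 (m s)))
        - (2 * Real.pi * Complex.I : ℂ) • total m e21 = _
    simp only [total, Finset.smul_sum, ← Finset.sum_sub_distrib]
    refine Finset.sum_congr rfl fun s _ => ?_
    module
  have hM10 : matM m z 1 0 a = (2 * Real.pi * Complex.I : ℂ) •
      ∑ s, (1 - a / z s)⁻¹ • site m s (e12 (m s)) := rfl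
  have hder : derU m (fun x => derU m (fun _ => v) x + (Real.pi * Complex.I * μ : ℂ) • v
      + matM m z 1 1 x v) a = ((Real.pi : ℂ) ^ 2) • ((-2 : ℂ) •
        ∑ s, ((1 - a / z s)⁻¹ * ((1 - a / z s)⁻¹ - 1)) • site m s (cartan (m s)) v) := by
    have h1 : (fun x => derU m (fun _ => v) x + (Real.pi * Complex.I * μ : ℂ) • v
        + matM m z 1 1 x v) = fun x => ((Real.pi * Complex.I * μ : ℂ) • v
          + ∑ s, (Real.pi * Complex.I / 2) • site m s (cartan (m s)) v)
          + ∑ s, (1 - x / z s)⁻¹ • (-(Real.pi * Complex.I) : ℂ) • site m s (cartan (m s)) v := by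
      funext x
      rw [derU_const, zero_add, hM11, add_assoc]
      simp only [LinearMap.smul_apply, LinearMap.sum_apply, Finset.smul_sum,
        ← Finset.sum_add_distrib]
      congr 1
      refine Finset.sum_congr rfl fun s _ => ?_
      module
    rw [h1, derU_sum m (g' := fun s a => (z s)⁻¹ * ((1 - a / z s)⁻¹) ^ 2)
      (fun s => hasDerivAt_inv_one_sub_div (hz0 s) (ha s)), Finset.smul_sum, Finset.smul_sum]
    refine Finset.sum_congr rfl fun s _ => ?_
    rw [smul_smul, smul_smul, smul_smul]
    congr 1
    have h0 : 1 - a / z s ≠ 0 := by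
      rw [sub_ne_zero]
      exact fun h => ha s ((div_eq_one_iff_eq (hz0 s)).1 h.symm)
    have h2 : a * (z s)⁻¹ * (1 - a / z s)⁻¹ = (1 - a / z s)⁻¹ - 1 := by
      rw [← div_eq_mul_inv]
      field_simp
      ring
    linear_combination (2 * Real.pi ^ 2 * Complex.I ^ 2 * (1 - a / z s)⁻¹) * h2
      + (2 * Real.pi ^ 2 * (1 - a / z s)⁻¹ * ((1 - a / z s)⁻¹ - 1)) * Complex.I_sq
  change derU m (fun x => derU m (fun _ => v) x + (Real.pi * Complex.I * μ : ℂ) • v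
      + matM m z 1 1 x v) a
    - (Real.pi * Complex.I * μ : ℂ) • (derU m (fun _ => v) a + (Real.pi * Complex.I * μ : ℂ) • v
      + matM m z 1 1 a v)
    + matM m z 0 0 a (derU m (fun _ => v) a + (Real.pi * Complex.I * μ : ℂ) • v
      + matM m z 1 1 a v) - matM m z 1 0 a (matM m z 0 1 a v) = _
  rw [hder, derU_const, zero_add, hM00, hM11, hM01, hM10, rawD2]
  have hsum : ∑ s, ((1 - a / z s)⁻¹ * ((1 - a / z s)⁻¹ - 1)) • site m s (cartan (m s)) v
      = (∑ s, ((1 - a / z s)⁻¹ * ((1 - a / z s)⁻¹ - 1)) • site m s (cartan (m s))) v := by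
    simp only [LinearMap.sum_apply, LinearMap.smul_apply]
  rw [hsum]
  generalize (∑ s, ((1 - a / z s)⁻¹ * ((1 - a / z s)⁻¹ - 1)) • site m s (cartan (m s))) = T
  generalize (∑ s, ((1 - a / z s)⁻¹ - 1 / 2) • site m s (cartan (m s))) = G
  generalize (∑ s, (1 - a / z s)⁻¹ • site m s (e12 (m s))) = P
  generalize (∑ s, ((1 - a / z s)⁻¹ - 1) • site m s (e21 (m s))) = Q
  simp only [LinearMap.smul_apply, LinearMap.add_apply, LinearMap.sub_apply,
    Module.End.mul_apply, Module.End.one_apply, map_add, map_sub, map_smul]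
  match_scalars <;> ring_nf <;> simp only [Complex.I_sq] <;> ring

/-- Expand by pairs of sites. Equal sites are handled by the Casimir; distinct sites by partial
fractions in `y_s y_t`, which produce the r-matrix. -/
theorem rawD2_eq {z : Fin n → ℂ} (hz0 : ∀ s, z s ≠ 0) (hz : Function.Injective z) (μ : ℂ) {a : ℂ}
    (ha : ∀ s, a ≠ z s) {y : Fin n → ℂ} (hy : ∀ s, y s = (1 - a / z s)⁻¹) :
    rawD2 m y μ = (μ • 1 + (1 / 2 : ℂ) • total m cartan) * (μ • 1 + (1 / 2 : ℂ) • total m cartan)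
      + (∑ s, y s * (y s - 1) * (m s * (m s + 2))) • 1
      - (4 : ℂ) • ∑ s, y s • gaudin m z μ s := by
  have hcas : ∀ s, site m s (e12 (m s)) * site m s (e21 (m s)) =
      ((m s : ℂ) * (m s + 2) / 4) • 1
        - (1 / 4 : ℂ) • (site m s (cartan (m s)) * site m s (cartan (m s)))
        + (1 / 2 : ℂ) • site m s (cartan (m s)) := by
    intro s
    rw [site_mul, site_mul, casimir, site_add, site_sub, site_smul, site_smul, site_smul,
      site_one]
  have hoff : ∑ s, ∑ t ∈ Finset.univ.erase s,
        (((y s - 1 / 2) * (y t - 1 / 2)) • (site m s (cartan (m s)) * site m t (cartan (m t)))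
          + (4 * (y s * (y t - 1))) • (site m s (e12 (m s)) * site m t (e21 (m t))))
      = ∑ s, ∑ t ∈ Finset.univ.erase s,
        ((1 / 4 : ℂ) • (site m s (cartan (m s)) * site m t (cartan (m t)))
          - (4 * y s) • rMatrix m s t (z s / z t)) := by
    refine sum_erase_eq_of_symm fun s t hst => ?_
    have h1 : z s - a ≠ 0 := sub_ne_zero.2 (ha s).symm
    have h2 : z t - a ≠ 0 := sub_ne_zero.2 (ha t).symm
    have h3 : z s - z t ≠ 0 := sub_ne_zero.2 (hz.ne hst)
    have h3' : z t - z s ≠ 0 := sub_ne_zero.2 (hz.ne hst.symm)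
    have h4 := hz0 s
    have h5 := hz0 t
    have h6 : y s = z s / (z s - a) := by rw [hy]; field_simp
    have h7 : y t = z t / (z t - a) := by rw [hy]; field_simp
    have h8 : z s / z t - 1 = (z s - z t) / z t := by field_simp
    have h9 : z t / z s - 1 = (z t - z s) / z s := by field_simp
    simp only [rMatrix, omegaPlus, omegaMinus, omega0_eq, h8, h9]
    rw [site_commute m hst.symm (cartan _), site_commute m hst.symm (e21 _) (e12 _),
      site_commute m hst (e21 _) (e12 _), h6, h7]
    match_scalars <;> field_simp <;> ring
  have hG : ∀ c : Fin n → ℂ, (∑ s, c s • site m s (cartan (m s)))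
      * (∑ s, c s • site m s (cartan (m s)))
      = ∑ s, (c s * c s) • (site m s (cartan (m s)) * site m s (cartan (m s)))
        + ∑ s, ∑ t ∈ Finset.univ.erase s,
          (c s * c t) • (site m s (cartan (m s)) * site m t (cartan (m t))) := by
    intro c
    rw [sum_mul_sum_erase]
    simp only [smul_mul_smul_comm]
  have hH : (1 / 2 : ℂ) • total m cartan = ∑ s, (1 / 2 : ℂ) • site m s (cartan (m s)) := by
    rw [total, Finset.smul_sum]
  have hK : (4 : ℂ) • ∑ s, y s • gaudin m z μ s = ∑ s, (2 * μ * y s) • site m s (cartan (m s))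
      + ∑ s, ∑ t ∈ Finset.univ.erase s, (4 * y s) • rMatrix m s t (z s / z t) := by
    rw [← Finset.sum_add_distrib, Finset.smul_sum]
    refine Finset.sum_congr rfl fun s _ => ?_
    rw [gaudin, ← Finset.smul_sum]
    module
  have hQ : ((∑ s, y s • site m s (e12 (m s))) * ∑ s, (y s - 1) • site m s (e21 (m s)))
      = ∑ s, (y s * (y s - 1)) • (site m s (e12 (m s)) * site m s (e21 (m s)))
        + ∑ s, ∑ t ∈ Finset.univ.erase s,
          (y s * (y t - 1)) • (site m s (e12 (m s)) * site m t (e21 (m t))) := by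
    rw [sum_mul_sum_erase]
    simp only [smul_mul_smul_comm]
  -- After inserting the Casimir, the coefficient of `h²` is `(y - 1/2)² - y(y - 1) = 1/4`, and the
  -- term `-2y(y - 1) h` cancels.
  have hdiag : ∑ s, ((-2 * (y s * (y s - 1))) • site m s (cartan (m s))
        + ((y s - 1 / 2) * (y s - 1 / 2)) • (site m s (cartan (m s)) * site m s (cartan (m s)))
        - (2 * μ * (y s - 1 / 2)) • site m s (cartan (m s))
        + (4 * (y s * (y s - 1))) • (site m s (e12 (m s)) * site m s (e21 (m s))))
      = ∑ s, ((1 / 2 * (1 / 2) : ℂ) • (site m s (cartan (m s)) * site m s (cartan (m s)))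
        + μ • site m s (cartan (m s)) + (y s * (y s - 1) * (m s * (m s + 2))) • 1
        - (2 * μ * y s) • site m s (cartan (m s))) := by
    refine Finset.sum_congr rfl fun s _ => ?_
    rw [hcas]
    module
  have hsq : ∀ G : Module.End ℂ (TensorV m), (G - μ • 1) * (G - μ • 1)
      = G * G - (2 * μ) • G + (μ * μ) • 1 := by
    intro G
    simp only [sub_mul, mul_sub, mul_smul_comm, smul_mul_assoc, mul_one, one_mul]
    module
  have hsq' : ∀ G : Module.End ℂ (TensorV m), (μ • 1 + G) * (μ • 1 + G)
      = G * G + (2 * μ) • G + (μ * μ) • 1 := by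
    intro G
    simp only [add_mul, mul_add, mul_smul_comm, smul_mul_assoc, mul_one, one_mul]
    module
  rw [rawD2, hsq, hsq', hG, hQ, hK, hH, hG fun _ => 1 / 2]
  simp only [Finset.sum_add_distrib, Finset.sum_sub_distrib, ← Finset.sum_smul] at hdiag hoff
  simp only [smul_add, Finset.smul_sum, smul_smul]
  have e1 : ∀ s, (2 * μ * (1 / 2 : ℂ)) • site m s (cartan (m s))
      = μ • site m s (cartan (m s)) := fun s => by module
  have e2 : (1 / 2 * (1 / 2) : ℂ) = 1 / 4 := by norm_num
  simp only [e1, e2] at hdiag hoff ⊢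
  have key := congrArg₂ (· + ·) hdiag hoff
  rw [← sub_eq_zero] at key ⊢
  rw [← key]
  module

theorem coeffD2_apply {z : Fin n → ℂ} (hz0 : ∀ s, z s ≠ 0) (hz : Function.Injective z) (μ : ℂ)
    {a : ℂ} (ha : ∀ s, a ≠ z s) {ν : ℂ} {v : TensorV m} (hv : v ∈ weightSpace m ν) :
    coeffD2 m z μ a v = ((Real.pi : ℂ) ^ 2 * ((μ + ν / 2) ^ 2
        + ∑ s, (1 - a / z s)⁻¹ * ((1 - a / z s)⁻¹ - 1) * (m s * (m s + 2)))) • v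
      - (4 * (Real.pi : ℂ) ^ 2) • ∑ s, (1 - a / z s)⁻¹ • gaudin m z μ s v := by
  have hv' := Module.End.mem_eigenspace_iff.1 hv
  rw [coeffD2_eq_rawD2 m hz0 μ ha, rawD2_eq m hz0 hz μ ha fun _ => rfl]
  simp only [LinearMap.smul_apply, LinearMap.add_apply, LinearMap.sub_apply,
    Module.End.mul_apply, Module.End.one_apply, map_add, map_smul, hv', LinearMap.sum_apply]
  module

end TrigGaudin

namespace TrigGaudin

variable {n : ℕ} {m : Fin n → ℕ}

/-! ## Conjugation by the dynamical Weyl group operator -/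

section Conj

variable {z : Fin n → ℂ} (hz0 : ∀ s, z s ≠ 0) (hz : Function.Injective z)
  {μ : ℂ} (hμ : ∀ k : ℤ, μ ≠ ((∑ s, m s : ℕ) : ℂ) / 2 + (k : ℂ)) (ν : ℂ)
include hz0 hz

theorem dynWeylEquiv_gaudinOn (s : Fin n) (v : weightSpace m ν) :
    dynWeylEquiv hμ ν (gaudinOn m z μ ν s v)
      = gaudinOn m z (-μ) (-ν) s (dynWeylEquiv hμ ν v) :=
  Subtype.ext (dynWeyl_gaudin hz0 hz hμ v.2 s)

theorem dynWeylEquiv_coeffD2On {a : ℂ} (ha : ∀ s, a ≠ z s) (v : weightSpace m ν) :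
    dynWeylEquiv hμ ν (coeffD2On m z μ ν a v)
      = coeffD2On m z (-μ) (-ν) a (dynWeylEquiv hμ ν v) := by
  refine Subtype.ext ?_
  change dynWeyl m (μ + ν / 2 - 1) (coeffD2 m z μ a v)
    = coeffD2 m z (-μ) a (dynWeyl m (μ + ν / 2 - 1) v)
  rw [coeffD2_apply m hz0 hz μ ha v.2,
    coeffD2_apply m hz0 hz (-μ) ha (dynWeyl_mem hμ v.2), map_sub, map_smul, map_smul, map_sum,
    -- The scalar part is the same for `(μ, ν)` and `(-μ, -ν)`, so only the Gaudin operators have to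
    -- be transported.
    show (-μ + -ν / 2) ^ 2 = (μ + ν / 2) ^ 2 by ring]
  simp only [map_smul, dynWeyl_gaudin hz0 hz hμ v.2]

theorem betheAlgebra_map :
    (betheAlgebra m z μ ν).map ((dynWeylEquiv hμ ν).conjAlgEquiv ℂ).toAlgHom
      = betheAlgebra m z (-μ) (-ν) := by
  have h : ∀ a : ℂ, (∀ s, a ≠ z s) →
      ((dynWeylEquiv hμ ν).conjAlgEquiv ℂ) (coeffD2On m z μ ν a) = coeffD2On m z (-μ) (-ν) a := by
    intro a ha
    refine LinearMap.ext fun w => ?_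
    obtain ⟨v, rfl⟩ := (dynWeylEquiv hμ ν).surjective w
    rw [← dynWeylEquiv_coeffD2On hz0 hz hμ ν ha]
    change dynWeylEquiv hμ ν (coeffD2On m z μ ν a ((dynWeylEquiv hμ ν).symm _)) = _
    rw [LinearEquiv.symm_apply_apply]
  rw [betheAlgebra, AlgHom.map_adjoin, betheAlgebra]
  congr 1
  ext T
  constructor
  · rintro ⟨_, ⟨a, ha, rfl⟩, rfl⟩
    exact ⟨a, ha, h a ha⟩
  · rintro ⟨a, ha, rfl⟩
    exact ⟨_, ⟨a, ha, rfl⟩, h a ha⟩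

end Conj

end TrigGaudin

end

/-! ### The main theorem -/

theorem mainTheorem11 {n : ℕ} (m : Fin n → ℕ) (hm : ∀ s, 0 < m s)
    (z : Fin n → ℂ) (hz0 : ∀ s, z s ≠ 0) (hz : Function.Injective z)
    (μ : ℂ) (hμ : ∀ k : ℤ, μ ≠ ((∑ s, m s : ℕ) : ℂ) / 2 + (k : ℂ)) (ν : ℤ) :
    ∃ Φ : TrigGaudin.weightSpace m (ν : ℂ) ≃ₗ[ℂ] TrigGaudin.weightSpace m (-(ν : ℂ)),
      (∀ v : TrigGaudin.weightSpace m (ν : ℂ),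
        (Φ v : TrigGaudin.TensorV m)
          = TrigGaudin.dynWeyl m (μ + (ν : ℂ) / 2 - 1) (v : TrigGaudin.TensorV m)) ∧
      (∃ Ψ : TrigGaudin.betheAlgebra m z μ (ν : ℂ) ≃ₐ[ℂ]
            TrigGaudin.betheAlgebra m z (-μ) (-(ν : ℂ)),
        ∀ T : TrigGaudin.betheAlgebra m z μ (ν : ℂ),
          (Ψ T : Module.End ℂ (TrigGaudin.weightSpace m (-(ν : ℂ))))
            = Φ.toLinearMap ∘ₗ (T : Module.End ℂ (TrigGaudin.weightSpace m (ν : ℂ)))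
                ∘ₗ Φ.symm.toLinearMap) ∧
      (∀ s : Fin n,
        Φ.toLinearMap ∘ₗ TrigGaudin.gaudinOn m z μ (ν : ℂ) s
          = TrigGaudin.gaudinOn m z (-μ) (-(ν : ℂ)) s ∘ₗ Φ.toLinearMap) := by
  refine ⟨TrigGaudin.dynWeylEquiv hμ ν, TrigGaudin.dynWeylEquiv_apply hμ ν,
    ⟨(((TrigGaudin.dynWeylEquiv hμ (ν : ℂ)).conjAlgEquiv ℂ).subalgebraMap
      (TrigGaudin.betheAlgebra m z μ (ν : ℂ))).trans
      (Subalgebra.equivOfEq _ _ (TrigGaudin.betheAlgebra_map hz0 hz hμ ν)), fun T => rfl⟩,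
    fun s => LinearMap.ext fun v => TrigGaudin.dynWeylEquiv_gaudinOn hz0 hz hμ ν s v⟩
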